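/- **Definitions.** An *MV-algebra* is an abelian monoid $(A,\oplus,0)$ with a unary operation $\neg$ such that $\neg\neg x=x$, $x\oplus\neg 0=\neg 0$ and $x\oplus\neg(x\oplus\neg y)=y\oplus\neg(y\oplus\neg x)$; the *standard MV-algebra* is $[0,1]$ with $x\oplus y=\min\{x+y,1\}$ and $\neg x=1-x$. A *simplex* in $\mathbb R^n$ is the convex hull of a non-empty finite affinely independent set, and a *polyhedron* is a finite (possibly empty) union of simplices. For a finite set $I$, a map $f\colon[0,1]^I\to[0,1]$ is *piecewise linear with integer coefficients* if it is continuous and there are finitely many affine functions $f_1,\dots,f_k\colon\mathbb R^I\to\mathbb R$ with integer coefficients such that for every $x$ there is $i$ with $f(x)=f_i(x)$; for an arbitrary set $I$, a map $[0,1]^I\to[0,1]$ is so if it factors as $f'\circ\pi_{I'}$ with $I'\subseteq I$ finite, $\pi_{I'}\colon[0,1]^I\to[0,1]^{I'}$ the projection, and $f'\colon[0,1]^{I'}\to[0,1]$ piecewise linear with integer coefficients. For $P\subseteq[0,1]^I$ and $Q\subseteq[0,1]^J$, a *$\mathbb Z$-map* $P\to Q$ is a map each of whose coordinates is the restriction to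 $P$ of a piecewise linear map $[0,1]^I\to[0,1]$ with integer coefficients. For $P\subseteq[0,1]^I$, let $\mathscr M(P)$ be the MV-algebra of all $\mathbb Z$-maps $P\to[0,1]$ with the pointwise operations. An MV-algebra is *finitely generated polyhedral* if it is isomorphic to $\mathscr M(P)$ for some $n\in\mathbb N$ and some polyhedron $P\subseteq[0,1]^n$. A subset $X\subseteq[0,1]^Y$, $Y$ an arbitrary set, is an *(infinite-dimensional) polyhedron* if for every finite $Z\subseteq Y$ the projection of $X$ to $[0,1]^Z$ is a polyhedron. An MV-algebra is *polyhedral* if it is isomorphic to $\mathscr M(X)$ for some closed (infinite-dimensional) polyhedron $X$ in some cube $[0,1]^Y$. **Theorem.** 1. An MV-algebra $A$ is polyhedral if, and only if, it is the colimit, in the category of MV-algebras and homomorphisms, of a diagram of finitely generated polyhedral MV-algebras indexed by a non-empty directed preordered set, all of whose transition maps are injective. 2. Let $Y$ be a set and let $X\subseteq[0,1]^Y$ be compact. Then $X$ is an (infinite-dimensional) polyhedron if, and only if, it is the inverse limit, in the category of closed subspaces of the cubes $[0,1]^I$ ($I$ any set) and $\mathbb Z$-maps, of an inverse system, indexed by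 a non-empty directed preordered set, of polyhedra in finite-dimensional cubes, all of whose transition maps are surjective $\mathbb Z$-maps. -/

import Mathlib

open CategoryTheory Limits
open scoped unitInterval

universe u v w

/-! ## MV-algebras -/

/-- An MV-algebra: an abelian monoid `(A, ⊕, 0)` with an operation `¬` such that `¬¬x = x`,
`x ⊕ ¬0 = ¬0` and `x ⊕ ¬(x ⊕ ¬y) = y ⊕ ¬(y ⊕ ¬x)`. -/
class MVAlgebra (A : Type u) where
  zero : A
  oplus : A → A → A
  neg : A → A
  oplus_assoc : ∀ x y z : A, oplus (oplus x y) z = oplus x (oplus y z)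
  oplus_comm : ∀ x y : A, oplus x y = oplus y x
  oplus_zero : ∀ x : A, oplus x zero = x
  neg_neg : ∀ x : A, neg (neg x) = x
  oplus_neg_zero : ∀ x : A, oplus x (neg zero) = neg zero
  lukasiewicz : ∀ x y : A, oplus x (neg (oplus x (neg y))) = oplus y (neg (oplus y (neg x)))

/-- Homomorphisms of MV-algebras. -/
@[ext]
structure MVHom (A : Type u) (B : Type v) [MVAlgebra A] [MVAlgebra B] where
  toFun : A → B
  map_zero : toFun MVAlgebra.zero = MVAlgebra.zero
  map_oplus : ∀ x y : A, toFun (MVAlgebra.oplus x y) = MVAlgebra.oplus (toFun x) (toFun y)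
  map_neg : ∀ x : A, toFun (MVAlgebra.neg x) = MVAlgebra.neg (toFun x)

/-- Two MV-algebras (possibly in different universes) are isomorphic. -/
def MVIsomorphic (A : Type u) (B : Type v) [MVAlgebra A] [MVAlgebra B] : Prop :=
  ∃ h : MVHom A B, Function.Bijective h.toFun

/-- The category of MV-algebras: objects. -/
structure MVCat : Type (u + 1) where
  carrier : Type u
  [str : MVAlgebra carrier]

instance (A : MVCat.{u}) : MVAlgebra A.carrier := A.str

instance : Category.{u} MVCat.{u} where
  Hom A B := MVHom A.carrier B.carrier
  id A := ⟨id, rfl, fun _ _ => rfl, fun _ => rfl⟩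
  comp f g := ⟨g.toFun ∘ f.toFun,
    by simp [f.map_zero, g.map_zero],
    fun x y => by simp [f.map_oplus, g.map_oplus],
    fun x => by simp [f.map_neg, g.map_neg]⟩

/-- The underlying function of a morphism of MV-algebras. -/
def MVCat.fn {A B : MVCat.{u}} (f : A ⟶ B) : A.carrier → B.carrier := MVHom.toFun f

/-- The standard MV-algebra `[0,1]`, with `x ⊕ y = min (x + y) 1` and `¬x = 1 - x`. -/
noncomputable instance : MVAlgebra I where
  zero := 0
  oplus x y := ⟨min ((x : ℝ) + y) 1, le_min (add_nonneg x.2.1 y.2.1) zero_le_one, min_le_right _ _⟩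
  neg x := ⟨1 - (x : ℝ), sub_nonneg.2 x.2.2, sub_le_self _ x.2.1⟩
  oplus_assoc x y z := by
    have hx := x.2.1; have hy := y.2.1; have hz := z.2.1
    apply Subtype.ext
    simp only [min_def]
    split_ifs <;> linarith
  oplus_comm x y := by
    apply Subtype.ext
    simp only [add_comm]
  oplus_zero x := by
    have hx := x.2.2
    apply Subtype.ext
    simp [hx]
  neg_neg x := by
    apply Subtype.ext
    simp
  oplus_neg_zero x := by
    have hx := x.2.1
    apply Subtype.ext
    simp [hx]
  lukasiewicz x y := by
    have hx := x.2.1; have hy := y.2.1; have hx' := x.2.2; have hy' := y.2.2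
    apply Subtype.ext
    simp only [min_def]
    split_ifs <;> linarith

/-! ## Polyhedra -/

/-- A (closed) simplex of `ℝ^ι`: the convex hull of a non-empty finite affinely independent
family of points. -/
def IsSimplex {ι : Type u} (S : Set (ι → ℝ)) : Prop :=
  ∃ (m : ℕ) (v : Fin (m + 1) → ι → ℝ), AffineIndependent ℝ v ∧ S = convexHull ℝ (Set.range v)

/-- A polyhedron of `ℝ^ι`, for `ι` finite: a finite union of simplices. -/
def IsRealPolyhedron {ι : Type u} [Finite ι] (P : Set (ι → ℝ)) : Prop :=
  ∃ T : Set (Set (ι → ℝ)), T.Finite ∧ (∀ S ∈ T, IsSimplex S) ∧ P = ⋃₀ T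

/-- The inclusion of the cube `[0,1]^Y` into `ℝ^Y`. -/
def cubeIncl {Y : Type u} (x : Y → I) : Y → ℝ := fun i => (x i : ℝ)

/-- A finite-dimensional polyhedron contained in the cube `[0,1]^ι`, for `ι` finite. -/
def IsPolyhedron {ι : Type u} [Finite ι] (P : Set (ι → I)) : Prop :=
  IsRealPolyhedron (cubeIncl '' P)

/-- An (infinite-dimensional) polyhedron in the Tychonoff cube `[0,1]^Y`: all the projections to
finite sets of coordinates are polyhedra. -/
def IsInfPolyhedron {Y : Type u} (X : Set (Y → I)) : Prop :=
  ∀ Z : Finset Y, IsPolyhedron ((Z.restrict : (Y → I) → (Z → I)) '' X)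

/-! ## Piecewise linear maps with integer coefficients -/

/-- Affine functions with integer coefficients on `ℝ^ι`, for `ι` finite. -/
def IsIntAffine {ι : Type u} [Fintype ι] (h : (ι → ℝ) → ℝ) : Prop :=
  ∃ (a : ι → ℤ) (b : ℤ), ∀ x : ι → ℝ, h x = ∑ i, (a i : ℝ) * x i + (b : ℝ)

/-- Piecewise linear functions `[0,1]^ι → [0,1]` with integer coefficients, for `ι` finite. -/
def IsIntPiecewiseLinear {ι : Type u} [Fintype ι] (f : (ι → I) → I) : Prop :=
  Continuous f ∧ ∃ T : Set ((ι → ℝ) → ℝ), T.Finite ∧ (∀ h ∈ T, IsIntAffine h) ∧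
    ∀ x : ι → I, ∃ h ∈ T, (f x : ℝ) = h (cubeIncl x)

/-- Piecewise linear functions `[0,1]^Y → [0,1]` with integer coefficients, for `Y` arbitrary:
those that factor through a function of this kind of finitely many coordinates. -/
def IsCubeZFun {Y : Type u} (ξ : (Y → I) → I) : Prop :=
  ∃ (s : Finset Y) (f : (s → I) → I), IsIntPiecewiseLinear f ∧ ∀ p, ξ p = f (s.restrict p)

/-- The `ℤ`-maps `X → [0,1]` for `X ⊆ [0,1]^Y`. -/
def IsZFun {Y : Type u} {X : Set (Y → I)} (f : X → I) : Prop :=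
  ∃ ξ : (Y → I) → I, IsCubeZFun ξ ∧ ∀ p : X, f p = ξ p

/-- The `ℤ`-maps `P → Q` for `P ⊆ [0,1]^Y` and `Q ⊆ [0,1]^W`. -/
def IsZMap {Y : Type u} {W : Type v} {P : Set (Y → I)} {Q : Set (W → I)} (η : P → Q) : Prop :=
  ∀ j : W, IsZFun (fun p : P => (η p : W → I) j)

/-! ### Closure properties of these functions -/

section IntAffine

variable {ι : Type u} {κ : Type v} [Fintype ι]

theorem IsIntAffine.const (b : ℤ) : IsIntAffine (fun _ : ι → ℝ => (b : ℝ)) :=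
  ⟨0, b, fun x => by simp⟩

theorem IsIntAffine.proj (i : ι) : IsIntAffine (fun x : ι → ℝ => x i) := by
  classical
  exact ⟨Pi.single i 1, 0, fun x => by simp [Pi.single_apply]⟩

theorem IsIntAffine.add {g h : (ι → ℝ) → ℝ} (hg : IsIntAffine g) (hh : IsIntAffine h) :
    IsIntAffine (fun x => g x + h x) := by
  obtain ⟨a, b, hg⟩ := hg
  obtain ⟨c, d, hh⟩ := hh
  refine ⟨a + c, b + d, fun x => ?_⟩
  simp only [hg, hh, Pi.add_apply, Int.cast_add, add_mul, Finset.sum_add_distrib]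
  ring

theorem IsIntAffine.smul (n : ℤ) {g : (ι → ℝ) → ℝ} (hg : IsIntAffine g) :
    IsIntAffine (fun x => (n : ℝ) * g x) := by
  obtain ⟨a, b, hg⟩ := hg
  refine ⟨fun i => n * a i, n * b, fun x => ?_⟩
  simp only [hg, Int.cast_mul, mul_add, Finset.mul_sum, mul_assoc]

theorem IsIntAffine.sum {g : κ → (ι → ℝ) → ℝ} (hg : ∀ k, IsIntAffine (g k)) (s : Finset κ) :
    IsIntAffine (fun x => ∑ k ∈ s, g k x) := by
  classical
  induction s using Finset.induction_on with
  | empty => simpa using IsIntAffine.const (ι := ι) 0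
  | insert k s hk ih =>
    simp only [Finset.sum_insert hk]
    exact (hg k).add ih

theorem IsIntAffine.comp [Fintype κ] {h : (κ → ℝ) → ℝ} (hh : IsIntAffine h) {g : κ → (ι → ℝ) → ℝ}
    (hg : ∀ k, IsIntAffine (g k)) : IsIntAffine (fun x => h (fun k => g k x)) := by
  obtain ⟨a, b, hh⟩ := hh
  simp only [hh]
  exact (IsIntAffine.sum (fun k => (hg k).smul (a k)) _).add (IsIntAffine.const b)

theorem IsIntPiecewiseLinear.comp [Fintype κ] {f : (κ → I) → I} (hf : IsIntPiecewiseLinear f)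
    {g : κ → (ι → I) → I} (hg : ∀ k, IsIntPiecewiseLinear (g k)) :
    IsIntPiecewiseLinear (fun x => f (fun k => g k x)) := by
  obtain ⟨hfc, T, hT, hTa, hTf⟩ := hf
  choose hgc U hU hUa hUg using hg
  refine ⟨hfc.comp (continuous_pi hgc),
    (fun q : ((κ → ℝ) → ℝ) × (κ → (ι → ℝ) → ℝ) => fun x => q.1 (fun k => q.2 k x)) ''
      (T ×ˢ Set.pi Set.univ U), (hT.prod (Set.Finite.pi' hU |>.subset ?_)).image _, ?_, ?_⟩
  · intro q hq k
    exact hq k trivial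
  · rintro _ ⟨q, ⟨hq1, hq2⟩, rfl⟩
    exact (hTa _ hq1).comp (fun k => hUa k _ (hq2 k trivial))
  · intro x
    obtain ⟨h, hh, hfx⟩ := hTf (fun k => g k x)
    choose r hr hrx using fun k => hUg k x
    refine ⟨_, ⟨(h, r), ⟨hh, fun k _ => hr k⟩, rfl⟩, ?_⟩
    rw [hfx]
    congr 1
    funext k
    exact hrx k

theorem IsIntPiecewiseLinear.proj (i : ι) : IsIntPiecewiseLinear (fun x : ι → I => x i) :=
  ⟨continuous_apply i, {fun x => x i}, Set.finite_singleton _,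
    fun h hh => by rw [Set.mem_singleton_iff.1 hh]; exact IsIntAffine.proj i,
    fun x => ⟨_, rfl, rfl⟩⟩

theorem IsIntPiecewiseLinear.zero :
    IsIntPiecewiseLinear (fun _ : ι → I => (MVAlgebra.zero : I)) :=
  ⟨continuous_const, {fun _ => ((0 : ℤ) : ℝ)}, Set.finite_singleton _,
    fun h hh => by rw [Set.mem_singleton_iff.1 hh]; exact IsIntAffine.const 0,
    fun x => ⟨_, rfl, by simp [MVAlgebra.zero]⟩⟩

theorem IsIntPiecewiseLinear.neg :
    IsIntPiecewiseLinear (fun x : Unit → I => MVAlgebra.neg (x ())) := by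
  refine ⟨?_, {fun x => ((1 : ℤ) : ℝ) + ((-1 : ℤ) : ℝ) * x ()}, Set.finite_singleton _,
    fun h hh => ?_, fun x => ⟨_, rfl, ?_⟩⟩
  · exact Continuous.subtype_mk (by fun_prop) _
  · rw [Set.mem_singleton_iff.1 hh]
    exact (IsIntAffine.const 1).add ((IsIntAffine.proj ()).smul (-1))
  · simp [MVAlgebra.neg, cubeIncl, sub_eq_add_neg]

theorem IsIntPiecewiseLinear.oplus :
    IsIntPiecewiseLinear (fun x : Bool → I => MVAlgebra.oplus (x true) (x false)) := by
  refine ⟨?_, {fun x => x true + x false, fun _ => ((1 : ℤ) : ℝ)}, by simp, ?_, fun x => ?_⟩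
  · exact Continuous.subtype_mk (by fun_prop) _
  · rintro h (rfl | rfl)
    · exact (IsIntAffine.proj true).add (IsIntAffine.proj false)
    · exact IsIntAffine.const 1
  · rcases min_choice ((x true : ℝ) + x false) 1 with h | h
    · exact ⟨_, Or.inl rfl, h⟩
    · exact ⟨_, Or.inr rfl, h.trans Int.cast_one.symm⟩

end IntAffine

theorem IsCubeZFun.comp {Y : Type u} {W : Type v} {ξ : (W → I) → I} (hξ : IsCubeZFun ξ)
    {η : W → (Y → I) → I} (hη : ∀ j, IsCubeZFun (η j)) :
    IsCubeZFun (fun p => ξ (fun j => η j p)) := by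
  classical
  obtain ⟨s, f, hf, hξ⟩ := hξ
  choose t g hg hη using hη
  have ht : ∀ j : s, t j ⊆ s.biUnion t := fun j => Finset.subset_biUnion_of_mem t j.2
  refine ⟨s.biUnion t, fun y => f (fun j => g j (fun i : t j => y ⟨i, ht j i.2⟩)), ?_, ?_⟩
  · exact hf.comp (fun j => (hg j).comp (fun i => IsIntPiecewiseLinear.proj _))
  · intro p
    simp only [hξ]
    congr 1
    funext j
    exact hη j p

theorem IsIntPiecewiseLinear.isCubeZFun {ι : Type u} [Fintype ι] {f : (ι → I) → I}
    (hf : IsIntPiecewiseLinear f) : IsCubeZFun f :=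
  ⟨Finset.univ, fun y => f (fun i => y ⟨i, Finset.mem_univ i⟩),
    hf.comp (fun i => IsIntPiecewiseLinear.proj (⟨i, Finset.mem_univ i⟩ : (Finset.univ : Finset ι))),
    fun _ => rfl⟩

theorem IsCubeZFun.proj {Y : Type u} (i : Y) : IsCubeZFun (fun p : Y → I => p i) :=
  ⟨{i}, fun y => y ⟨i, Finset.mem_singleton_self i⟩, IsIntPiecewiseLinear.proj _, fun _ => rfl⟩

section ZFun

variable {Y : Type u} {X : Set (Y → I)}

theorem IsZFun.zero : IsZFun (fun _ : X => (MVAlgebra.zero : I)) :=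
  ⟨fun _ => MVAlgebra.zero, ⟨∅, _, IsIntPiecewiseLinear.zero, fun _ => rfl⟩, fun _ => rfl⟩

theorem IsZFun.neg {f : X → I} (hf : IsZFun f) : IsZFun (fun p => MVAlgebra.neg (f p)) := by
  obtain ⟨ξ, hξ, hf⟩ := hf
  exact ⟨_, IsIntPiecewiseLinear.neg.isCubeZFun.comp (η := fun _ => ξ) (fun _ => hξ),
    fun p => by simp [hf]⟩

theorem IsZFun.oplus {f g : X → I} (hf : IsZFun f) (hg : IsZFun g) :
    IsZFun (fun p => MVAlgebra.oplus (f p) (g p)) := by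
  obtain ⟨ξ, hξ, hf⟩ := hf
  obtain ⟨ζ, hζ, hg⟩ := hg
  exact ⟨_, IsIntPiecewiseLinear.oplus.isCubeZFun.comp (η := fun b => cond b ξ ζ)
    (fun b => by cases b <;> assumption), fun p => by simp [hf, hg]⟩

theorem IsZMap.id : IsZMap (fun p : X => p) :=
  fun j => ⟨_, IsCubeZFun.proj j, fun _ => rfl⟩

theorem IsZMap.comp {W : Type v} {V : Type w} {Q : Set (W → I)} {R : Set (V → I)}
    {η : X → Q} {θ : Q → R} (hθ : IsZMap θ) (hη : IsZMap η) : IsZMap (θ ∘ η) := by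
  intro k
  obtain ⟨ξ, hξ, h⟩ := hθ k
  choose ζ hζ h' using hη
  refine ⟨_, hξ.comp hζ, fun p => ?_⟩
  simp only [Function.comp_apply, h]
  congr 1
  funext j
  exact h' j p

end ZFun

/-! ## The MV-algebra of `ℤ`-maps and polyhedral MV-algebras -/

/-- The MV-algebra of all `ℤ`-maps `X → [0,1]`, a subalgebra of `[0,1]^X`. -/
def McN {Y : Type u} (X : Set (Y → I)) : Type u := {f : X → I // IsZFun f}

noncomputable instance {Y : Type u} (X : Set (Y → I)) : MVAlgebra (McN X) where
  zero := ⟨fun _ => MVAlgebra.zero, IsZFun.zero⟩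
  oplus f g := ⟨fun p => MVAlgebra.oplus (f.1 p) (g.1 p), f.2.oplus g.2⟩
  neg f := ⟨fun p => MVAlgebra.neg (f.1 p), f.2.neg⟩
  oplus_assoc _ _ _ := Subtype.ext (funext fun _ => MVAlgebra.oplus_assoc _ _ _)
  oplus_comm _ _ := Subtype.ext (funext fun _ => MVAlgebra.oplus_comm _ _)
  oplus_zero _ := Subtype.ext (funext fun _ => MVAlgebra.oplus_zero _)
  neg_neg _ := Subtype.ext (funext fun _ => MVAlgebra.neg_neg _)
  oplus_neg_zero _ := Subtype.ext (funext fun _ => MVAlgebra.oplus_neg_zero _)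
  lukasiewicz _ _ := Subtype.ext (funext fun _ => MVAlgebra.lukasiewicz _ _)

/-- Finitely generated polyhedral MV-algebras. -/
def IsFGPolyhedralMV (A : Type u) [MVAlgebra A] : Prop :=
  ∃ (n : ℕ) (P : Set (Fin n → I)), IsPolyhedron P ∧ MVIsomorphic A (McN P)

/-- Polyhedral MV-algebras. -/
def IsPolyhedralMV (A : Type u) [MVAlgebra A] : Prop :=
  ∃ (Y : Type u) (X : Set (Y → I)), IsClosed X ∧ IsInfPolyhedron X ∧ MVIsomorphic A (McN X)

/-! ## The category of closed subspaces of Tychonoff cubes and `ℤ`-maps -/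

/-- A closed subspace of a Tychonoff cube `[0,1]^Y`. -/
structure CubeSpace : Type (u + 1) where
  coords : Type u
  set : Set (coords → I)
  isClosed : IsClosed set

/-- The `ℤ`-maps between closed subspaces of Tychonoff cubes. -/
def CubeSpace.ZHom (P Q : CubeSpace.{u}) : Type u := {η : P.set → Q.set // IsZMap η}

instance : Category.{u} CubeSpace.{u} where
  Hom P Q := CubeSpace.ZHom P Q
  id P := ⟨fun p => p, IsZMap.id⟩
  comp f g := ⟨g.1 ∘ f.1, IsZMap.comp g.2 f.2⟩

/-- The underlying function of a morphism. -/
def CubeSpace.fn {P Q : CubeSpace.{u}} (f : P ⟶ Q) : P.set → Q.set := Subtype.val f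

/-- A closed subspace of a finite-dimensional cube which is a polyhedron. -/
def CubeSpace.IsFinDimPolyhedron (P : CubeSpace.{u}) : Prop :=
  ∃ _ : Finite P.coords, IsPolyhedron P.set

/-! Both equivalences rest on two facts: a `ℤ`-function depends on finitely many coordinates, and
the image of a finite-dimensional polyhedron under a `ℤ`-map is a polyhedron (`IsPolyhedron.image`).
The second holds because a polytope can be cut until the map is affine on each piece.

The easy directions use the projections of `X` to finite sets of coordinates. They form an inverse
system with limit `X` and surjective transition maps; passing to algebras of `ℤ`-functions gives a
directed system of embeddings with colimit `𝓜(X)`.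

For the converse in the algebraic case, `X` is the set of all homomorphisms from `A` to `[0,1]`,
inside `[0,1]^A`. Homomorphisms from `𝓜(P)` to `[0,1]` are evaluations at points of `P`, by
compactness and the incomparability of kernels (`mvSpec_subset_of_separating`). The same lemma
extends homomorphisms along embeddings, and a compactness argument (`exists_thread`) extends them
from a term of the system to the colimit. So finite projections of `X` are images of the given
polyhedra, and evaluation `A → 𝓜(X)` is an isomorphism.

For the converse in the geometric case, the limit is a retract of the explicit set of threads, so
finitely many coordinates of `X` factor through one term of the system, onto which `X` projects
surjectively. -/

/-! ## Finite unions of polytopes -/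

section Polytopes

variable {E : Type*} [NormedAddCommGroup E] [NormedSpace ℝ E]

theorem AffineMap.map_sum_smul {E F : Type*} [AddCommGroup E] [Module ℝ E] [AddCommGroup F]
    [Module ℝ F] (l : E →ᵃ[ℝ] F) {κ : Type*} (s : Finset κ) (c : κ → ℝ) (z : κ → E)
    (hc : ∑ k ∈ s, c k = 1) : l (∑ k ∈ s, c k • z k) = ∑ k ∈ s, c k • l (z k) := by
  have h : ∀ x, l x = l.linear x + l 0 := fun x => congrFun l.decomp x
  rw [h]
  simp only [fun k => h (z k), smul_add, Finset.sum_add_distrib, ← Finset.sum_smul, hc, one_smul,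
    map_sum, map_smul]

/-- The intersection of a polytope with a closed half-space is a polytope. -/
theorem exists_convexHull_eq_inter_halfSpace (V : Finset E) (l : E →ᵃ[ℝ] ℝ) :
    ∃ W : Finset E, convexHull ℝ (W : Set E) = convexHull ℝ (V : Set E) ∩ {x | l x ≤ 0} := by
  classical
  set N := V.filter (fun v => l v ≤ 0) with hN
  set Q := V.filter (fun v => ¬ l v ≤ 0) with hQ
  have hNl : ∀ v ∈ N, l v ≤ 0 := fun v hv => (Finset.mem_filter.1 hv).2
  have hQl : ∀ v ∈ Q, 0 < l v := fun v hv => not_le.1 (Finset.mem_filter.1 hv).2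
  have hNV : ∀ v ∈ N, v ∈ V := fun v hv => (Finset.mem_filter.1 hv).1
  have hQV : ∀ v ∈ Q, v ∈ V := fun v hv => (Finset.mem_filter.1 hv).1
  -- For `v ∈ N` and `w ∈ Q`, `c (v, w)` is the zero of `l` on the segment from `v` to `w`.
  set c : E × E → E := fun q => (l q.2 - l q.1)⁻¹ • (l q.2 • q.1 + (-l q.1) • q.2) with hcdef
  refine ⟨N ∪ (N ×ˢ Q).image c, subset_antisymm ?_ ?_⟩
  · refine convexHull_min ?_ ((convex_convexHull ℝ _).inter ?_)
    · intro x hx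
      rcases Finset.mem_union.1 (Finset.mem_coe.1 hx) with hx | hx
      · exact ⟨subset_convexHull ℝ _ (hNV x hx), hNl x hx⟩
      · obtain ⟨⟨v, w⟩, hq, rfl⟩ := Finset.mem_image.1 hx
        obtain ⟨hv, hw⟩ := Finset.mem_product.1 hq
        have h1 := hNl v hv
        have h2 := hQl w hw
        have h3 : 0 < l w - l v := by linarith
        have hsum : (l w - l v)⁻¹ * l w + (l w - l v)⁻¹ * (-l v) = 1 := by
          field_simp
          ring
        have hc : c (v, w) = ((l w - l v)⁻¹ * l w) • v + ((l w - l v)⁻¹ * (-l v)) • w := by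
          simp only [hcdef, smul_add, smul_smul]
        refine ⟨?_, ?_⟩
        · rw [hc]
          exact convex_convexHull ℝ _ (subset_convexHull ℝ _ (hNV v hv))
            (subset_convexHull ℝ _ (hQV w hw))
            (mul_nonneg (inv_nonneg.2 h3.le) h2.le)
            (mul_nonneg (inv_nonneg.2 h3.le) (by linarith)) hsum
        · have := l.map_sum_smul (Finset.univ : Finset (Fin 2))
            ![(l w - l v)⁻¹ * l w, (l w - l v)⁻¹ * (-l v)] ![v, w] (by simpa using hsum)
          simp only [Fin.sum_univ_two, Matrix.cons_val_zero, Matrix.cons_val_one] at this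
          change l (c (v, w)) ≤ 0
          rw [hc, this]
          simp only [smul_eq_mul]
          exact le_of_eq (by ring)
    · intro x hx y hy a b ha hb hab
      have := l.map_sum_smul (Finset.univ : Finset (Fin 2)) ![a, b] ![x, y] (by simpa using hab)
      simp only [Fin.sum_univ_two, Matrix.cons_val_zero, Matrix.cons_val_one] at this
      change l _ ≤ 0
      rw [this]
      exact add_nonpos (mul_nonpos_of_nonneg_of_nonpos ha hx)
        (mul_nonpos_of_nonneg_of_nonpos hb hy)
  · rintro x ⟨hx, hlx⟩
    obtain ⟨a, ha, ha1, rfl⟩ := Finset.mem_convexHull'.1 hx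
    have hlx' : l (∑ v ∈ V, a v • v) ≤ 0 := hlx
    rw [l.map_sum_smul V a (fun v => v) ha1] at hlx'
    simp only [smul_eq_mul] at hlx'
    rw [Finset.sum_filter_add_sum_filter_not V (fun v => l v ≤ 0) (fun v => a v * l v)
      |>.symm] at hlx'
    rw [(Finset.sum_filter_add_sum_filter_not V (fun v => l v ≤ 0) a).symm] at ha1
    rw [(Finset.sum_filter_add_sum_filter_not V (fun v => l v ≤ 0) (fun v => a v • v)).symm]
    rw [← hN, ← hQ] at *
    -- `M` and `D` are the positive and negative parts of the value of `l` at the point, which is `M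
    -- - D ≤ 0`.
    set M := ∑ v ∈ Q, a v * l v with hM
    set D := -∑ v ∈ N, a v * l v with hD
    have hM0 : 0 ≤ M := Finset.sum_nonneg fun v hv => mul_nonneg (ha v (hQV v hv)) (hQl v hv).le
    have hMD : M ≤ D := by linarith
    have hsub : ∀ v ∈ N, v ∈ convexHull ℝ ((N ∪ (N ×ˢ Q).image c : Finset E) : Set E) :=
      fun v hv => subset_convexHull ℝ _ (Finset.mem_coe.2 (Finset.mem_union_left _ hv))
    rcases (hM0.trans hMD).eq_or_lt with hD0 | hD0
    · have hMz : M = 0 := le_antisymm (hD0 ▸ hMD) hM0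
      have hz : ∀ v ∈ Q, a v = 0 := fun v hv => by
        have := (Finset.sum_eq_zero_iff_of_nonneg fun v hv =>
          mul_nonneg (ha v (hQV v hv)) (hQl v hv).le).1 hMz v hv
        exact (mul_eq_zero.1 this).resolve_right (hQl v hv).ne'
      rw [Finset.sum_eq_zero hz, add_zero] at ha1
      rw [Finset.sum_eq_zero (s := Q) (fun v hv => by rw [hz v hv, zero_smul]), add_zero]
      exact (convex_convexHull ℝ _).sum_mem (fun v hv => ha v (hNV v hv)) ha1 hsub
    · have hpair : ∀ q ∈ N ×ˢ Q, 0 < l q.2 - l q.1 := fun q hq => by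
        have h1 := hNl _ (Finset.mem_product.1 hq).1
        have h2 := hQl _ (Finset.mem_product.1 hq).2
        linarith
      -- Each positive vertex is balanced against all the negative ones in proportion to their share
      -- of `D`. The crossing points then use up all of `a w` for `w ∈ Q` and the fraction `M / D`
      -- of `a v` for `v ∈ N`; the rest stays on `N`.
      set wt : (E × E) ⊕ E → ℝ := Sum.elim (fun q => a q.1 * a q.2 * (l q.2 - l q.1) / D)
        (fun v => (1 - M / D) * a v) with hwt
      set pt : (E × E) ⊕ E → E := Sum.elim c id with hpt
      have hkey : ∑ i ∈ (N ×ˢ Q).disjSum N, wt i • pt i = ∑ v ∈ N, a v • v + ∑ v ∈ Q, a v • v := by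
        rw [Finset.sum_disjSum]
        have h1 : ∑ q ∈ N ×ˢ Q, wt (Sum.inl q) • pt (Sum.inl q) =
            ∑ q ∈ N ×ˢ Q, ((a q.2 * l q.2 / D) • (a q.1 • q.1) +
              (-(a q.1 * l q.1) / D) • (a q.2 • q.2)) := by
          refine Finset.sum_congr rfl fun q hq => ?_
          have h := (hpair q hq).ne'
          simp only [hwt, hpt, hcdef, Sum.elim_inl, smul_smul, smul_add]
          congr 2 <;> field_simp
        rw [h1, Finset.sum_add_distrib, Finset.sum_product_right, Finset.sum_product]
        simp only [← Finset.smul_sum, ← Finset.sum_smul]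
        rw [← Finset.sum_div, ← hM, ← Finset.sum_div, Finset.sum_neg_distrib,
          ← hD, div_self hD0.ne', one_smul]
        simp only [hwt, hpt, Sum.elim_inr, id, mul_smul, ← Finset.smul_sum]
        rw [sub_smul, one_smul]
        abel
      have hone : ∑ i ∈ (N ×ˢ Q).disjSum N, wt i = 1 := by
        rw [Finset.sum_disjSum]
        have h1 : ∑ q ∈ N ×ˢ Q, wt (Sum.inl q) =
            ∑ q ∈ N ×ˢ Q, ((a q.2 * l q.2 / D) * a q.1 + (-(a q.1 * l q.1) / D) * a q.2) := by
          refine Finset.sum_congr rfl fun q hq => ?_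
          simp only [hwt, Sum.elim_inl]
          ring
        rw [h1, Finset.sum_add_distrib, Finset.sum_product_right, Finset.sum_product]
        simp only [← Finset.mul_sum, ← Finset.sum_mul]
        rw [← Finset.sum_div, ← hM, ← Finset.sum_div, Finset.sum_neg_distrib, ← hD,
          div_self hD0.ne']
        refine Eq.trans ?_ ha1
        simp only [hwt, Sum.elim_inr, ← Finset.mul_sum]
        ring
      rw [← hkey]
      refine (convex_convexHull ℝ _).sum_mem ?_ hone ?_
      · rintro (q | v) hi
        · have hq := Finset.inl_mem_disjSum.1 hi
          have hq' := Finset.mem_product.1 hq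
          exact div_nonneg (mul_nonneg (mul_nonneg (ha _ (hNV _ hq'.1)) (ha _ (hQV _ hq'.2)))
            (hpair q hq).le) hD0.le
        · have hv := Finset.inr_mem_disjSum.1 hi
          exact mul_nonneg (sub_nonneg.2 ((div_le_one hD0).2 hMD)) (ha _ (hNV _ hv))
      · rintro (q | v) hi
        · have hq := Finset.inl_mem_disjSum.1 hi
          exact subset_convexHull ℝ _ (Finset.mem_coe.2 (Finset.mem_union_right _
            (Finset.mem_image_of_mem c hq)))
        · exact hsub v (Finset.inr_mem_disjSum.1 hi)

/-- The function `l` does not change sign on `C`. -/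
def ConstantSign (l : E →ᵃ[ℝ] ℝ) (C : Set E) : Prop :=
  (∀ x ∈ C, l x ≤ 0) ∨ (∀ x ∈ C, 0 ≤ l x)

/-- A polytope is a finite union of polytopes on each of which finitely many given affine
functions do not change sign. -/
theorem exists_subdivision (V : Finset E) {L : Set (E →ᵃ[ℝ] ℝ)} (hL : L.Finite) :
    ∃ T : Set (Finset E), T.Finite ∧
      convexHull ℝ (V : Set E) = ⋃ W ∈ T, convexHull ℝ (W : Set E) ∧
      ∀ W ∈ T, ∀ l ∈ L, ConstantSign l (convexHull ℝ (W : Set E)) := by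
  induction L, hL using Set.Finite.induction_on with
  | empty => exact ⟨{V}, Set.finite_singleton _, by simp, by simp⟩
  | @insert l L _ _ ih =>
    obtain ⟨T, hT, hVT, hTL⟩ := ih
    choose f hf using fun W : Finset E => exists_convexHull_eq_inter_halfSpace W l
    choose g hg using fun W : Finset E => exists_convexHull_eq_inter_halfSpace W (-l)
    refine ⟨f '' T ∪ g '' T, (hT.image f).union (hT.image g), ?_, ?_⟩
    · rw [hVT, Set.biUnion_union, Set.biUnion_image, Set.biUnion_image]
      simp only [← Set.iUnion_union_distrib]
      refine Set.iUnion₂_congr fun W _ => ?_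
      rw [hf, hg, ← Set.inter_union_distrib_left, eq_comm, Set.inter_eq_left]
      intro x _
      rcases le_total (l x) 0 with h | h
      · exact Or.inl h
      · exact Or.inr (by simpa using h)
    · rintro _ (⟨W, hW, rfl⟩ | ⟨W, hW, rfl⟩) m hm
      · rcases hm with rfl | hm
        · exact Or.inl fun x hx => ((hf W).subset hx).2
        · exact (hTL W hW m hm).imp (fun h x hx => h x ((hf W).subset hx).1)
            (fun h x hx => h x ((hf W).subset hx).1)
      · rcases hm with rfl | hm
        · refine Or.inr fun x hx => ?_
          simpa using ((hg W).subset hx).2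
        · exact (hTL W hW m hm).imp (fun h x hx => h x ((hg W).subset hx).1)
            (fun h x hx => h x ((hg W).subset hx).1)

/-- An affine function without change of sign on a polytope and vanishing at the barycentre of
its vertices vanishes on the polytope. -/
theorem ConstantSign.eq_zero {V : Finset E} (hV : V.Nonempty) {l : E →ᵃ[ℝ] ℝ}
    (hl : ConstantSign l (convexHull ℝ (V : Set E)))
    (h0 : l (∑ v ∈ V, ((V.card : ℝ)⁻¹) • v) = 0) :
    ∀ x ∈ convexHull ℝ (V : Set E), l x = 0 := by
  have hcard : (0 : ℝ) < V.card := by exact_mod_cast hV.card_pos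
  rw [l.map_sum_smul V (fun _ => (V.card : ℝ)⁻¹) (fun v => v)
    (by simp [hcard.ne']), ← Finset.smul_sum, smul_eq_mul, mul_eq_zero,
    or_iff_right (inv_ne_zero hcard.ne')] at h0
  -- The values at the vertices have one sign and sum to zero.
  have hz : ∀ v ∈ V, l v = 0 := by
    rcases hl with hl | hl
    · exact (Finset.sum_eq_zero_iff_of_nonpos
        (fun v hv => hl v (subset_convexHull ℝ _ (Finset.mem_coe.2 hv)))).1 h0
    · exact (Finset.sum_eq_zero_iff_of_nonneg
        (fun v hv => hl v (subset_convexHull ℝ _ (Finset.mem_coe.2 hv)))).1 h0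
  intro x hx
  obtain ⟨a, -, ha1, rfl⟩ := Finset.mem_convexHull'.1 hx
  rw [l.map_sum_smul V a (fun v => v) ha1]
  exact Finset.sum_eq_zero fun v hv => by simp [hz v hv]

/-- A continuous function that is everywhere on a polytope equal to one of finitely many affine
functions is affine if none of their differences changes sign. -/
theorem exists_eqOn_convexHull {V : Finset E} (hV : V.Nonempty) {f : E → ℝ}
    (hf : ContinuousOn f (convexHull ℝ (V : Set E))) {T : Set (E →ᵃ[ℝ] ℝ)} (hT : T.Finite)
    (hfT : ∀ x ∈ convexHull ℝ (V : Set E), ∃ h ∈ T, f x = h x)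
    (hsign : ∀ g ∈ T, ∀ h ∈ T, ConstantSign (g - h) (convexHull ℝ (V : Set E))) :
    ∃ h ∈ T, ∀ x ∈ convexHull ℝ (V : Set E), f x = h x := by
  have hcard : (0 : ℝ) < V.card := by exact_mod_cast hV.card_pos
  set C := convexHull ℝ (V : Set E) with hC
  set b := ∑ v ∈ V, ((V.card : ℝ)⁻¹) • v with hb
  have hbC : b ∈ C := (convex_convexHull ℝ _).sum_mem (fun _ _ => inv_nonneg.2 hcard.le)
    (by simp [hcard.ne']) (fun v hv => subset_convexHull ℝ _ (Finset.mem_coe.2 hv))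
  -- The piece valid at the barycentre is the right one: any other piece with the same value there
  -- coincides with it on all of `C`.
  obtain ⟨h, hhT, hfb⟩ := hfT b hbC
  refine ⟨h, hhT, fun x hx => ?_⟩
  -- The segment from `b` to `x`, with the parameter clamped so that `y` stays in `C` for every real
  -- `t`.
  set y : ℝ → E := fun t => AffineMap.lineMap b x (Set.projIcc (0 : ℝ) 1 zero_le_one t : ℝ) with hy
  have hyC : ∀ t, y t ∈ C := fun t => (convex_convexHull ℝ _).lineMap_mem hbC hx (Subtype.prop _)
  have hyc : Continuous y :=
    AffineMap.lineMap_continuous.comp (continuous_subtype_val.comp continuous_projIcc)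
  have hfy : Continuous (fun t => f (y t)) := hf.comp_continuous hyc hyC
  have hay : ∀ (g : E →ᵃ[ℝ] ℝ) t, g (y t) = AffineMap.lineMap (g b) (g x)
      (Set.projIcc (0 : ℝ) 1 zero_le_one t : ℝ) := fun g t => AffineMap.apply_lineMap _ _ _ _
  have hgy : ∀ g : E →ᵃ[ℝ] ℝ, Continuous (fun t => g (y t)) := fun g => by
    simp only [hay]
    exact AffineMap.lineMap_continuous.comp (continuous_subtype_val.comp continuous_projIcc)
  set A : Set ℝ := {t | f (y t) = h (y t)} with hA
  set B : Set ℝ := ⋃ g ∈ {g ∈ T | g b ≠ h b}, {t | f (y t) = g (y t)} with hB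
  have hAc : IsClosed A := isClosed_eq hfy (hgy h)
  have hBc : IsClosed B := (hT.subset (Set.sep_subset _ _)).isClosed_biUnion
    fun g _ => isClosed_eq hfy (hgy g)
  have hcover : ∀ t, t ∈ A ∪ B := fun t => by
    obtain ⟨g, hg, hfg⟩ := hfT (y t) (hyC t)
    by_cases hgb : g b = h b
    · left
      have := (hsign g hg h hhT).eq_zero hV (by simpa [sub_eq_zero] using hgb) (y t) (hyC t)
      exact hfg.trans (by simpa [sub_eq_zero] using this)
    · exact Or.inr (Set.mem_biUnion (show g ∈ {g ∈ T | g b ≠ h b} from ⟨hg, hgb⟩) hfg)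
  -- If `g - h` has constant sign and is nonzero at `b`, it can vanish on the segment only at the
  -- end `x`. Hence the half-open interval, on which connectedness excludes `B`; the end point
  -- follows by closure.
  have hdisj : ∀ t ∈ Set.Ico (0 : ℝ) 1, t ∈ A → t ∉ B := by
    intro t ht htA htB
    obtain ⟨g, ⟨hg, hgb⟩, hfg⟩ := Set.mem_iUnion₂.1 htB
    have heq : g (y t) = h (y t) := (show f (y t) = g (y t) from hfg).symm.trans htA
    rw [hay, hay, Set.projIcc_of_mem zero_le_one ⟨ht.1, ht.2.le⟩, AffineMap.lineMap_apply_ring',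
      AffineMap.lineMap_apply_ring'] at heq
    have h1 : (1 - t) * (g b - h b) + t * (g x - h x) = 0 := by
      simp only at heq
      linear_combination heq
    have h2 : 0 < 1 - t := by linarith [ht.2]
    rcases hsign g hg h hhT with hs | hs
    · have hsb : g b - h b ≤ 0 := hs b hbC
      have hsx : g x - h x ≤ 0 := hs x hx
      have := mul_neg_of_pos_of_neg h2 (lt_of_le_of_ne hsb (sub_ne_zero.2 hgb))
      have := mul_nonpos_of_nonneg_of_nonpos ht.1 hsx
      linarith
    · have hsb : 0 ≤ g b - h b := hs b hbC
      have hsx : 0 ≤ g x - h x := hs x hx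
      have := mul_pos h2 (lt_of_le_of_ne hsb (sub_ne_zero.2 hgb).symm)
      have := mul_nonneg ht.1 hsx
      linarith
  have hIco : Set.Ico (0 : ℝ) 1 ⊆ A := by
    intro t ht
    by_contra htA
    have h0 : (0 : ℝ) ∈ Set.Ico (0 : ℝ) 1 := ⟨le_rfl, zero_lt_one⟩
    have h0A : (0 : ℝ) ∈ A := by
      have : y 0 = b := by simp [hy]
      simpa [hA, this] using hfb
    obtain ⟨s, hs, hsA, hsB⟩ := isPreconnected_closed_iff.1 isPreconnected_Ico A B hAc hBc
      (fun t _ => hcover t) ⟨0, h0, h0A⟩ ⟨t, ht, (hcover t).resolve_left htA⟩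
    exact hdisj s hs hsA hsB
  have h1 : (1 : ℝ) ∈ A := by
    refine (closure_minimal hIco hAc) ?_
    rw [closure_Ico (zero_ne_one' ℝ)]
    exact ⟨zero_le_one, le_rfl⟩
  have : y 1 = x := by simp [hy]
  simpa [hA, this] using h1

end Polytopes

/-! ## Images of polyhedra -/

section Polyhedra

variable {ι : Type u} {κ : Type v} [Finite ι] [Finite κ]

/-- Carathéodory's theorem: the hull is the union of the hulls of the affinely independent subsets.
-/
theorem isRealPolyhedron_convexHull (V : Finset (ι → ℝ)) :
    IsRealPolyhedron (convexHull ℝ (V : Set (ι → ℝ))) := by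
  classical
  refine ⟨(fun t : Finset (ι → ℝ) => convexHull ℝ (t : Set (ι → ℝ))) ''
    {t | t ⊆ V ∧ t.Nonempty ∧ AffineIndependent ℝ ((↑) : t → ι → ℝ)}, ?_, ?_, ?_⟩
  · exact ((V.powerset.finite_toSet).subset fun t ht => Finset.mem_coe.2
      (Finset.mem_powerset.2 ht.1)).image _
  · rintro _ ⟨t, ⟨-, htn, hti⟩, rfl⟩
    obtain ⟨m, hm⟩ := Nat.exists_eq_succ_of_ne_zero htn.card_pos.ne'
    set e : Fin (m + 1) ≃ t := (finCongr hm.symm).trans t.equivFin.symm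
    refine ⟨m, fun i => e i, hti.comp_embedding e.toEmbedding, ?_⟩
    change _ = convexHull ℝ (Set.range (((↑) : t → ι → ℝ) ∘ e))
    rw [e.surjective.range_comp, Subtype.range_coe_subtype]
    rfl
  · rw [convexHull_eq_union, Set.sUnion_image]
    ext x
    simp only [Set.mem_iUnion, Set.mem_ofPred_eq, exists_prop]
    constructor
    · rintro ⟨t, h1, h2, h3⟩
      exact ⟨t, ⟨Finset.coe_subset.1 h1, Finset.coe_nonempty.1
        (convexHull_nonempty_iff.1 ⟨x, h3⟩), h2⟩, h3⟩
    · rintro ⟨t, ⟨h1, -, h2⟩, h3⟩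
      exact ⟨t, Finset.coe_subset.2 h1, h2, h3⟩

theorem IsRealPolyhedron.biUnion {α : Type w} {s : Set α} (hs : s.Finite) {P : α → Set (ι → ℝ)}
    (hP : ∀ i ∈ s, IsRealPolyhedron (P i)) : IsRealPolyhedron (⋃ i ∈ s, P i) := by
  choose! T hT hTs hPT using hP
  refine ⟨⋃ i ∈ s, T i, hs.biUnion hT, ?_, ?_⟩
  · intro S hS
    obtain ⟨i, hi, hS⟩ := Set.mem_iUnion₂.1 hS
    exact hTs i hi S hS
  · rw [Set.sUnion_iUnion]
    simp only [Set.sUnion_iUnion]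
    exact Set.iUnion₂_congr hPT

theorem IsSimplex.exists_finset {ι : Type u} {S : Set (ι → ℝ)} (hS : IsSimplex S) :
    ∃ V : Finset (ι → ℝ), S = convexHull ℝ (V : Set (ι → ℝ)) := by
  classical
  obtain ⟨m, v, -, rfl⟩ := hS
  exact ⟨Finset.univ.image v, by simp⟩

theorem IsSimplex.isCompact {ι : Type u} {S : Set (ι → ℝ)} (hS : IsSimplex S) : IsCompact S := by
  obtain ⟨V, rfl⟩ := hS.exists_finset
  exact V.finite_toSet.isCompact_convexHull ℝ

theorem IsRealPolyhedron.isCompact {P : Set (ι → ℝ)} (hP : IsRealPolyhedron P) : IsCompact P := by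
  obtain ⟨T, hT, hTs, rfl⟩ := hP
  exact hT.isCompact_sUnion fun S hS => (hTs S hS).isCompact

theorem continuous_cubeIncl {Y : Type u} : Continuous (cubeIncl : (Y → I) → Y → ℝ) :=
  continuous_pi fun i => continuous_subtype_val.comp (continuous_apply i)

theorem cubeIncl_injective {Y : Type u} : Function.Injective (cubeIncl : (Y → I) → Y → ℝ) :=
  fun _ _ h => funext fun i => Subtype.ext (congrFun h i)

theorem IsPolyhedron.isClosed {P : Set (ι → I)} (hP : IsPolyhedron P) : IsClosed P := by
  rw [← cubeIncl_injective.preimage_image P]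
  exact (IsRealPolyhedron.isCompact hP).isClosed.preimage continuous_cubeIncl

/-- The image of a polyhedron under a continuous map whose coordinates are given by finitely many
affine functions is a polyhedron. -/
theorem IsRealPolyhedron.image {P : Set (ι → ℝ)} (hP : IsRealPolyhedron P)
    {f : (ι → ℝ) → κ → ℝ} (hf : ContinuousOn f P) {T : Set ((ι → ℝ) →ᵃ[ℝ] ℝ)} (hT : T.Finite)
    (hfT : ∀ x ∈ P, ∀ k, ∃ h ∈ T, f x k = h x) : IsRealPolyhedron (f '' P) := by
  classical
  have := Fintype.ofFinite ι
  have := Fintype.ofFinite κ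
  obtain ⟨U, hU, hUs, rfl⟩ := hP
  rw [Set.sUnion_eq_biUnion, Set.image_iUnion₂]
  refine IsRealPolyhedron.biUnion hU fun S hS => ?_
  obtain ⟨V, hSV⟩ := (hUs S hS).exists_finset
  -- Cutting along all differences of two pieces makes every coordinate of `f` affine on each part.
  obtain ⟨R, hR, hVR, hRs⟩ := exists_subdivision V (hT.image2 (fun g h => g - h) hT)
  rw [hSV, hVR, Set.image_iUnion₂]
  refine IsRealPolyhedron.biUnion hR fun W hW => ?_
  rcases W.eq_empty_or_nonempty with rfl | hWn
  · exact ⟨∅, Set.finite_empty, by simp, by simp⟩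
  have hWS : convexHull ℝ (W : Set (ι → ℝ)) ⊆ ⋃₀ U := fun x hx =>
    ⟨S, hS, (hSV.trans hVR).symm ▸ Set.mem_biUnion hW hx⟩
  choose h _ hh using fun k => exists_eqOn_convexHull hWn (f := fun x => f x k)
    (((continuous_apply k).comp_continuousOn hf).mono hWS) hT (fun x hx => hfT x (hWS hx) k)
    (fun g hg h hh => hRs W hW _ (Set.mem_image2_of_mem hg hh))
  have himg : f '' convexHull ℝ (W : Set (ι → ℝ)) =
      convexHull ℝ ((W.image (AffineMap.pi h) : Finset (κ → ℝ)) : Set (κ → ℝ)) := by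
    rw [Finset.coe_image, ← AffineMap.image_convexHull]
    exact Set.image_congr fun x hx => funext fun k => hh k x hx
  rw [himg]
  exact isRealPolyhedron_convexHull _

theorem IsIntAffine.exists_affineMap {ι : Type u} [Fintype ι] {h : (ι → ℝ) → ℝ}
    (hh : IsIntAffine h) : ∃ l : (ι → ℝ) →ᵃ[ℝ] ℝ, ∀ x, h x = l x := by
  obtain ⟨a, b, hh⟩ := hh
  exact ⟨(∑ i, (a i : ℝ) • LinearMap.proj i : (ι → ℝ) →ₗ[ℝ] ℝ).toAffineMap +
    AffineMap.const ℝ _ (b : ℝ), fun x => by simp [hh]⟩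

theorem IsCubeZFun.continuous {Y : Type u} {ξ : (Y → I) → I} (hξ : IsCubeZFun ξ) :
    Continuous ξ := by
  obtain ⟨s, f, hf, hξ⟩ := hξ
  rw [funext hξ]
  exact hf.1.comp (continuous_pi fun i => continuous_apply (i : Y))

/-- Integrality of the coefficients is forgotten here: images of polyhedra only need affine pieces.
-/
theorem IsCubeZFun.exists_affineMap {ι : Type u} {ξ : (ι → I) → I} (hξ : IsCubeZFun ξ) :
    ∃ T : Set ((ι → ℝ) →ᵃ[ℝ] ℝ), T.Finite ∧ ∀ x, ∃ h ∈ T, (ξ x : ℝ) = h (cubeIncl x) := by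
  obtain ⟨s, f, ⟨-, T, hT, hTa, hTf⟩, hξ⟩ := hξ
  choose! l hl using fun h (hh : h ∈ T) => (hTa h hh).exists_affineMap
  refine ⟨(fun h => (l h).comp (LinearMap.funLeft ℝ ℝ ((↑) : s → ι)).toAffineMap) '' T,
    hT.image _, fun x => ?_⟩
  obtain ⟨h, hh, hx⟩ := hTf (s.restrict x)
  refine ⟨_, ⟨h, hh, rfl⟩, ?_⟩
  rw [hξ, hx, hl h hh]
  rfl

/-- The image of a polyhedron under a `ℤ`-map is a polyhedron. -/
theorem IsPolyhedron.image {P : Set (ι → I)} (hP : IsPolyhedron P) {η : κ → (ι → I) → I}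
    (hη : ∀ k, IsCubeZFun (η k)) : IsPolyhedron ((fun x k => η k x) '' P) := by
  choose T hT hηT using fun k => (hη k).exists_affineMap
  -- Clamping retracts `ℝ^ι` onto the cube, so that `η k ∘ ρ` is a continuous function on all of
  -- `ℝ^ι`.
  set ρ : (ι → ℝ) → ι → I := fun x i => Set.projIcc (0 : ℝ) 1 zero_le_one (x i) with hρ
  have hρc : Continuous ρ := continuous_pi fun i => continuous_projIcc.comp (continuous_apply i)
  have hρi : ∀ x, ρ (cubeIncl x) = x := fun x => funext fun i => Set.projIcc_val _ _
  have key := IsRealPolyhedron.image (f := fun x k => ((η k (ρ x) : I) : ℝ)) hP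
    (Continuous.continuousOn (continuous_pi fun k =>
      continuous_subtype_val.comp ((hη k).continuous.comp hρc)))
    (Set.finite_iUnion hT) (by
      rintro _ ⟨x, -, rfl⟩ k
      obtain ⟨h, hh, hx⟩ := hηT k x
      exact ⟨h, Set.mem_iUnion.2 ⟨k, hh⟩, by rw [hρi]; exact hx⟩)
  rw [Set.image_image] at key
  unfold IsPolyhedron
  rw [Set.image_image]
  simp only [hρi] at key
  exact key

theorem IsZMap.isPolyhedron_range {P : Set (ι → I)} (hP : IsPolyhedron P) {Q : Set (κ → I)}
    {η : P → Q} (hη : IsZMap η) : IsPolyhedron (Set.range fun p => (η p : κ → I)) := by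
  choose ξ hξ hηξ using hη
  convert hP.image hξ using 1
  ext x
  constructor
  · rintro ⟨p, rfl⟩
    exact ⟨p, p.2, funext fun k => (hηξ k p).symm⟩
  · rintro ⟨p, hp, rfl⟩
    exact ⟨⟨p, hp⟩, funext fun k => hηξ k ⟨p, hp⟩⟩

end Polyhedra

/-! ## Homomorphisms to the standard MV-algebra -/

section Spectrum

variable {A : Type u} {B : Type v} {C : Type w} [MVAlgebra A] [MVAlgebra B] [MVAlgebra C]

/-- The composition of homomorphisms of MV-algebras. -/
def MVHom.comp (g : MVHom B C) (f : MVHom A B) : MVHom A C where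
  toFun := g.toFun ∘ f.toFun
  map_zero := by simp [f.map_zero, g.map_zero]
  map_oplus x y := by simp [f.map_oplus, g.map_oplus]
  map_neg x := by simp [f.map_neg, g.map_neg]

/-- The inverse of a bijective homomorphism. -/
noncomputable def MVHom.inverse (f : MVHom A B) (hf : Function.Bijective f.toFun) : MVHom B A where
  toFun := (Equiv.ofBijective f.toFun hf).symm
  map_zero := by rw [Equiv.symm_apply_eq]; exact f.map_zero.symm
  map_oplus x y := by
    rw [Equiv.symm_apply_eq, Equiv.ofBijective_apply, f.map_oplus]
    simp only [Equiv.ofBijective_apply_symm_apply]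
  map_neg x := by
    rw [Equiv.symm_apply_eq, Equiv.ofBijective_apply, f.map_neg]
    simp only [Equiv.ofBijective_apply_symm_apply]

theorem unitInterval.coe_mvZero : ((MVAlgebra.zero : I) : ℝ) = 0 := rfl

theorem unitInterval.coe_mvNeg (x : I) : ((MVAlgebra.neg x : I) : ℝ) = 1 - x := rfl

theorem unitInterval.coe_mvOplus (x y : I) :
    ((MVAlgebra.oplus x y : I) : ℝ) = min ((x : ℝ) + y) 1 := rfl

/-- The underlying maps of the homomorphisms from `B` to the standard MV-algebra. -/
def mvSpec (B : Type v) [MVAlgebra B] : Set (B → I) :=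
  Set.range (MVHom.toFun : MVHom B I → B → I)

theorem mem_mvSpec_iff {x : B → I} : x ∈ mvSpec B ↔
    x MVAlgebra.zero = MVAlgebra.zero ∧
    (∀ a b, x (MVAlgebra.oplus a b) = MVAlgebra.oplus (x a) (x b)) ∧
    ∀ a, x (MVAlgebra.neg a) = MVAlgebra.neg (x a) :=
  ⟨by rintro ⟨h, rfl⟩; exact ⟨h.map_zero, h.map_oplus, h.map_neg⟩,
    fun h => ⟨⟨x, h.1, h.2.1, h.2.2⟩, rfl⟩⟩

theorem continuous_mvOplus : Continuous fun p : I × I => (MVAlgebra.oplus p.1 p.2 : I) :=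
  Continuous.subtype_mk (by fun_prop) _

theorem continuous_mvNeg : Continuous fun p : I => (MVAlgebra.neg p : I) :=
  Continuous.subtype_mk (by fun_prop) _

theorem isClosed_mvSpec : IsClosed (mvSpec B) := by
  have : mvSpec B = {x | x MVAlgebra.zero = MVAlgebra.zero} ∩
      ((⋂ (a : B) (b : B), {x | x (MVAlgebra.oplus a b) = MVAlgebra.oplus (x a) (x b)}) ∩
        ⋂ a : B, {x | x (MVAlgebra.neg a) = MVAlgebra.neg (x a)}) := by
    ext x
    simp only [mem_mvSpec_iff, Set.mem_inter_iff, Set.mem_iInter, Set.mem_ofPred_eq]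
  rw [this]
  refine (isClosed_eq (continuous_apply _) continuous_const).inter (IsClosed.inter ?_ ?_)
  · exact isClosed_iInter fun a => isClosed_iInter fun b => isClosed_eq (continuous_apply _)
      (continuous_mvOplus.comp (f := fun x : B → I => (x a, x b)) ((continuous_apply a).prodMk (continuous_apply b)))
  · exact isClosed_iInter fun a => isClosed_eq (continuous_apply _)
      (continuous_mvNeg.comp (continuous_apply a))

theorem comp_mem_mvSpec {y : B → I} (hy : y ∈ mvSpec B) (f : MVHom A B) :
    y ∘ f.toFun ∈ mvSpec A := by
  obtain ⟨h, rfl⟩ := hy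
  exact ⟨h.comp f, rfl⟩

/-- The gap between the two values is doubled repeatedly: by `f ⊕ f` when both are at most `1/2`,
and by `¬(¬f ⊕ ¬f)`, which acts on values as `t ↦ max (2t - 1) 0`, when both exceed `1/2`. When
`1/2` separates the values, the latter operation gives the result. A gap is at most `1`, so the
doubling stops. -/
theorem exists_zero_pos_of_lt (x y : MVHom B I) (f : B) (hf : (x.toFun f : ℝ) < y.toFun f) :
    ∃ g, (x.toFun g : ℝ) = 0 ∧ (0 : ℝ) < y.toFun g := by
  obtain ⟨n, hn⟩ : ∃ n : ℕ, 1 < 2 ^ n * ((y.toFun f : ℝ) - x.toFun f) := by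
    obtain ⟨n, hn⟩ := pow_unbounded_of_one_lt (1 / ((y.toFun f : ℝ) - x.toFun f))
      (one_lt_two : (1 : ℝ) < 2)
    exact ⟨n, (div_lt_iff₀ (sub_pos.2 hf)).1 hn⟩
  induction n generalizing f with
  | zero =>
    have h1 := (y.toFun f).2.2
    have h2 := (x.toFun f).2.1
    rw [pow_zero, one_mul] at hn
    linarith
  | succ n ih =>
    have h1 := (y.toFun f).2.2
    have h2 := (x.toFun f).2.1
    rw [pow_succ] at hn
    by_cases hy : (y.toFun f : ℝ) ≤ 1 / 2
    · refine ih (MVAlgebra.oplus f f) ?_ ?_ <;>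
      · simp only [x.map_oplus, y.map_oplus, unitInterval.coe_mvOplus]
        rw [min_eq_left (by linarith), min_eq_left (by linarith)]
        linarith
    · set g := MVAlgebra.neg (MVAlgebra.oplus (MVAlgebra.neg f) (MVAlgebra.neg f)) with hg
      have hxg : (x.toFun g : ℝ) = 1 - min ((1 - (x.toFun f : ℝ)) + (1 - x.toFun f)) 1 := by
        simp only [hg, x.map_neg, x.map_oplus, unitInterval.coe_mvOplus, unitInterval.coe_mvNeg]
      have hyg : (y.toFun g : ℝ) = 1 - min ((1 - (y.toFun f : ℝ)) + (1 - y.toFun f)) 1 := by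
        simp only [hg, y.map_neg, y.map_oplus, unitInterval.coe_mvOplus, unitInterval.coe_mvNeg]
      rw [min_eq_left (by linarith)] at hyg
      by_cases hx : (x.toFun f : ℝ) ≤ 1 / 2
      · rw [min_eq_right (by linarith)] at hxg
        exact ⟨g, by linarith, by linarith⟩
      · rw [min_eq_left (by linarith)] at hxg
        refine ih g ?_ ?_ <;> rw [hxg, hyg] <;> linarith

/-- Distinct homomorphisms to the standard MV-algebra have incomparable kernels. -/
theorem exists_zero_pos_of_ne {x y : B → I} (hx : x ∈ mvSpec B) (hy : y ∈ mvSpec B)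
    (hxy : x ≠ y) : ∃ g, (x g : ℝ) = 0 ∧ (0 : ℝ) < y g := by
  obtain ⟨x, rfl⟩ := hx
  obtain ⟨y, rfl⟩ := hy
  obtain ⟨f, hf⟩ := Function.ne_iff.1 hxy
  rcases lt_or_gt_of_ne (fun h => hf (Subtype.ext h) : (x.toFun f : ℝ) ≠ y.toFun f) with h | h
  · exact exists_zero_pos_of_lt x y f h
  · refine exists_zero_pos_of_lt x y (MVAlgebra.neg f) ?_
    simp only [x.map_neg, y.map_neg, unitInterval.coe_mvNeg]
    linarith

/-- At each point of `K` a multiple of some member of `N` exceeds `1/2`, hence also nearby. The sum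
of the members from a finite subcover dominates each of them, and its double is `1` on all of `K`.
-/
theorem exists_forall_eq_one {K : Set (B → I)} (hK : IsCompact K) (hKs : K ⊆ mvSpec B) {N : Set B}
    (hN0 : MVAlgebra.zero ∈ N) (hN : ∀ a ∈ N, ∀ b ∈ N, MVAlgebra.oplus a b ∈ N)
    (hpos : ∀ x ∈ K, ∃ f ∈ N, (0 : ℝ) < x f) : ∃ f ∈ N, ∀ x ∈ K, (x f : ℝ) = 1 := by
  have hmul : ∀ f ∈ N, ∀ n : ℕ, ∃ g ∈ N, ∀ x ∈ mvSpec B, (x g : ℝ) = min (n * (x f : ℝ)) 1 := by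
    intro f hf n
    induction n with
    | zero =>
      refine ⟨MVAlgebra.zero, hN0, fun x hx => ?_⟩
      rw [(mem_mvSpec_iff.1 hx).1, unitInterval.coe_mvZero]
      simp
    | succ n ih =>
      obtain ⟨g, hg, hgx⟩ := ih
      refine ⟨MVAlgebra.oplus g f, hN g hg f hf, fun x hx => ?_⟩
      rw [(mem_mvSpec_iff.1 hx).2.1, unitInterval.coe_mvOplus, hgx x hx, Nat.cast_succ, add_mul,
        one_mul]
      have := (x f).2.1
      rcases le_total (n * (x f : ℝ)) 1 with h | h
      · rw [min_eq_left h]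
      · rw [min_eq_right h, min_eq_right (by linarith), min_eq_right (by linarith)]
  have hone : ∀ x ∈ K, ∃ f ∈ N, (1 / 2 : ℝ) < x f := fun x hx => by
    obtain ⟨f, hf, hxf⟩ := hpos x hx
    obtain ⟨n, hn⟩ := exists_nat_gt (1 / (x f : ℝ))
    obtain ⟨g, hg, hgx⟩ := hmul f hf n
    refine ⟨g, hg, ?_⟩
    rw [hgx x (hKs hx), min_eq_right ((div_lt_iff₀ hxf).1 hn).le]
    norm_num
  have : Nonempty B := ⟨MVAlgebra.zero⟩
  choose! f hf hxf using hone
  obtain ⟨t, htK, ht⟩ := hK.elim_nhds_subcover (fun x => {y : B → I | (1 / 2 : ℝ) < y (f x)})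
    fun x hx => (isOpen_lt continuous_const
      (continuous_subtype_val.comp (continuous_apply (f x)))).mem_nhds (hxf x hx)
  have hsum : ∀ s : Finset (B → I), (∀ x ∈ s, x ∈ K) →
      ∃ g ∈ N, ∀ x ∈ s, ∀ y ∈ mvSpec B, (y (f x) : ℝ) ≤ y g := by
    classical
    intro s
    induction s using Finset.induction_on with
    | empty => exact fun _ => ⟨_, hN0, by simp⟩
    | insert a s _ ih =>
      intro hs
      obtain ⟨g, hg, hgx⟩ := ih fun x hx => hs x (Finset.mem_insert_of_mem hx)
      refine ⟨_, hN _ (hf a (hs a (Finset.mem_insert_self _ _))) g hg, fun x hx y hy => ?_⟩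
      rw [(mem_mvSpec_iff.1 hy).2.1, unitInterval.coe_mvOplus]
      refine le_min ?_ (y (f x)).2.2
      rcases Finset.mem_insert.1 hx with rfl | hx
      · exact le_add_of_nonneg_right (y g).2.1
      · exact (hgx x hx y hy).trans (le_add_of_nonneg_left (y (f a)).2.1)
  obtain ⟨g, hg, hgx⟩ := hsum t htK
  obtain ⟨g', hg', hgx'⟩ := hmul g hg 2
  refine ⟨g', hg', fun y hy => ?_⟩
  obtain ⟨x, hx, hxy⟩ := Set.mem_iUnion₂.1 (ht hy)
  rw [hgx' y (hKs hy)]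
  have h1 := hgx x hx y (hKs hy)
  have h2 : (1 / 2 : ℝ) < y (f x) := hxy
  exact min_eq_right (by push_cast; linarith)

/-- A compact set of homomorphisms to the standard MV-algebra with zero common kernel contains
all of them. -/
theorem mvSpec_subset_of_separating {K : Set (B → I)} (hK : IsCompact K) (hKs : K ⊆ mvSpec B)
    (hsep : ∀ f : B, (∀ x ∈ K, x f = MVAlgebra.zero) → f = MVAlgebra.zero) : mvSpec B ⊆ K := by
  intro y hy
  have hy' := mem_mvSpec_iff.1 hy
  by_contra hyK
  -- If `y ∉ K`, incomparability of kernels gives, for each point of `K`, an element of the kernel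
  -- of `y` that is positive there. So some `f` in this kernel is `1` on `K`; then `¬f` vanishes on
  -- `K`, so `¬f = 0`, although `y` sends it to `1`.
  obtain ⟨f, hf, hfx⟩ := exists_forall_eq_one hK hKs (N := {f | y f = MVAlgebra.zero}) hy'.1
    (fun a ha b hb => by
      change y _ = _
      rw [hy'.2.1, show y a = _ from ha, show y b = _ from hb, MVAlgebra.oplus_zero])
    (fun x hx => by
      obtain ⟨g, hg, hxg⟩ := exists_zero_pos_of_ne hy (hKs hx) (fun h => hyK (h ▸ hx))
      exact ⟨g, Subtype.ext hg, hxg⟩)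
  have h0 := hsep (MVAlgebra.neg f) fun x hx => Subtype.ext <| by
    rw [(mem_mvSpec_iff.1 (hKs hx)).2.2, unitInterval.coe_mvNeg, hfx x hx, sub_self]
    rfl
  have h1 := congrArg Subtype.val (hy'.2.2 f)
  rw [h0, hy'.1, show y f = _ from hf, unitInterval.coe_mvNeg, unitInterval.coe_mvZero] at h1
  norm_num at h1

/-- A homomorphism to the standard MV-algebra extends along an embedding into an MV-algebra in
which zero is the only element killed by all homomorphisms to the standard one. -/
theorem exists_extension_mvSpec (φ : MVHom B C) (hφ : Function.Injective φ.toFun)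
    (hC : ∀ f : C, (∀ x ∈ mvSpec C, x f = MVAlgebra.zero) → f = MVAlgebra.zero)
    {y : B → I} (hy : y ∈ mvSpec B) : ∃ x ∈ mvSpec C, x ∘ φ.toFun = y := by
  have hcont : Continuous fun x : C → I => x ∘ φ.toFun :=
    continuous_pi fun b => continuous_apply (φ.toFun b)
  -- The restrictions of homomorphisms on `C` form a compact set with zero common kernel, so they
  -- are all the homomorphisms on `B`.
  refine mvSpec_subset_of_separating (isClosed_mvSpec.isCompact.image hcont) ?_ ?_ hy
  · rintro _ ⟨x, hx, rfl⟩
    exact comp_mem_mvSpec hx φ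
  · intro f hf
    refine hφ ?_
    rw [φ.map_zero]
    exact hC _ fun x hx => hf _ ⟨x, hx, rfl⟩

end Spectrum

/-! ## Algebras of `ℤ`-maps -/

section McN

variable {Y : Type u} {W : Type v} {P : Set (Y → I)} {Q : Set (W → I)}

theorem IsZFun.comp {f : Q → I} (hf : IsZFun f) {η : P → Q} (hη : IsZMap η) :
    IsZFun (fun p => f (η p)) := by
  obtain ⟨ξ, hξ, h⟩ := hf
  choose ζ hζ h' using hη
  refine ⟨_, hξ.comp hζ, fun p => ?_⟩
  exact (h (η p)).trans (congrArg ξ (funext fun j => h' j p))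

theorem IsZFun.continuous {f : P → I} (hf : IsZFun f) : Continuous f := by
  obtain ⟨ξ, hξ, h⟩ := hf
  rw [funext h]
  exact hξ.continuous.comp continuous_subtype_val

theorem IsZMap.continuous {η : P → Q} (hη : IsZMap η) : Continuous η :=
  Continuous.subtype_mk (f := fun p => (η p : W → I)) (continuous_pi fun j => (hη j).continuous)
    fun p => (η p).2

/-- The homomorphism of MV-algebras induced by a `ℤ`-map. -/
noncomputable def McN.pullback (η : P → Q) (hη : IsZMap η) : MVHom (McN Q) (McN P) where
  toFun f := ⟨fun p => f.1 (η p), f.2.comp hη⟩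
  map_zero := rfl
  map_oplus _ _ := rfl
  map_neg _ := rfl

theorem McN.pullback_injective {η : P → Q} (hη : IsZMap η) (hs : Function.Surjective η) :
    Function.Injective (McN.pullback η hη).toFun := fun f g h => Subtype.ext <| funext fun q => by
  obtain ⟨p, rfl⟩ := hs q
  exact congrFun (congrArg Subtype.val h) p

/-- The evaluation at a point. -/
noncomputable def McN.eval (p : P) : MVHom (McN P) I where
  toFun f := f.1 p
  map_zero := rfl
  map_oplus _ _ := rfl
  map_neg _ := rfl

/-- Every homomorphism from an algebra isomorphic to `𝓜(P)`, `P` closed, to the standard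
MV-algebra is the evaluation at a point of `P`. -/
theorem exists_eq_eval {A : Type w} [MVAlgebra A] (hP : IsClosed P) (e : MVHom A (McN P))
    (he : Function.Injective e.toFun) {y : A → I} (hy : y ∈ mvSpec A) :
    ∃ p : P, ∀ a, y a = (e.toFun a).1 p := by
  have : CompactSpace P := isCompact_iff_compactSpace.1 hP.isCompact
  -- The evaluations are a compact family, and injectivity of `e` makes their common kernel zero.
  obtain ⟨p, hp⟩ := mvSpec_subset_of_separating
    (isCompact_range (f := fun (p : P) (a : A) => (e.toFun a).1 p)
      (continuous_pi fun a => (e.toFun a).2.continuous)) (by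
      rintro _ ⟨p, rfl⟩
      exact ⟨(McN.eval p).comp e, rfl⟩) (fun f hf => he (by
      rw [e.map_zero]
      exact Subtype.ext (funext fun p => hf _ ⟨p, rfl⟩))) hy
  exact ⟨p, fun a => (congrFun hp a).symm⟩

theorem eval_mem_mvSpec {A : Type w} [MVAlgebra A] (e : MVHom A (McN P)) (p : P) :
    (fun a => (e.toFun a).1 p) ∈ mvSpec A := ⟨(McN.eval p).comp e, rfl⟩

/-- Evaluations already detect zero. This supplies the separation hypothesis of the extension
lemmas. -/
theorem eq_zero_of_mvSpec {A : Type w} [MVAlgebra A] (e : MVHom A (McN P))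
    (he : Function.Injective e.toFun) (a : A) (ha : ∀ x ∈ mvSpec A, x a = MVAlgebra.zero) :
    a = MVAlgebra.zero := he (by
  rw [e.map_zero]
  exact Subtype.ext (funext fun p => ha _ (eval_mem_mvSpec e p)))

/-- The algebra of a polyhedron in `[0,1]^ι`, `ι` finite, is finitely generated polyhedral. -/
theorem isFGPolyhedralMV_mcN {ι : Type u} [Finite ι] {P : Set (ι → I)} (hP : IsPolyhedron P) :
    IsFGPolyhedralMV (McN P) := by
  obtain ⟨n, ⟨e⟩⟩ := Finite.exists_equiv_fin ι
  refine ⟨n, (fun x k => x (e.symm k)) '' P, hP.image fun k => IsCubeZFun.proj (e.symm k), ?_⟩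
  set P' : Set (Fin n → I) := (fun x k => x (e.symm k)) '' P with hP'
  have hmem : ∀ q ∈ P', (fun i => q (e i)) ∈ P := by
    rintro _ ⟨p, hp, rfl⟩
    simpa using hp
  set η : P' → P := fun q => ⟨fun i => q.1 (e i), hmem q q.2⟩ with hη
  have hηZ : IsZMap η := fun i => ⟨_, IsCubeZFun.proj (e i), fun _ => rfl⟩
  set θ : P → P' := fun p => ⟨fun k => p.1 (e.symm k), ⟨p, p.2, rfl⟩⟩ with hθ
  have hθZ : IsZMap θ := fun k => ⟨_, IsCubeZFun.proj (e.symm k), fun _ => rfl⟩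
  refine ⟨McN.pullback η hηZ, McN.pullback_injective hηZ fun p => ⟨θ p, ?_⟩,
    fun f => ⟨(McN.pullback θ hθZ).toFun f, ?_⟩⟩
  · exact Subtype.ext (funext fun i => by simp [hη, hθ])
  · refine Subtype.ext (funext fun q => ?_)
    change f.1 (θ (η q)) = f.1 q
    exact congrArg f.1 (Subtype.ext (funext fun i => by simp [hη, hθ]))

end McN

/-! ## Inverse systems of compact spaces -/

/-- In a directed inverse system of compact Hausdorff spaces with surjective transition maps,
every point of every space belongs to a thread. -/
theorem exists_thread {J : Type u} [Preorder J] [IsDirectedOrder J] {K : J → Type v}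
    [∀ j, TopologicalSpace (K j)] [∀ j, CompactSpace (K j)] [∀ j, T2Space (K j)]
    (φ : ∀ {i j : J}, i ≤ j → K j → K i) (hφ : ∀ {i j : J} (h : i ≤ j), Continuous (φ h))
    (hcomp : ∀ {i j k : J} (h : i ≤ j) (h' : j ≤ k) (x : K k), φ h (φ h' x) = φ (h.trans h') x)
    (hsurj : ∀ {i j : J} (h : i ≤ j), Function.Surjective (φ h)) (j : J) (p : K j) :
    ∃ x : ∀ i, K i, x j = p ∧ ∀ {i k : J} (h : i ≤ k), φ h (x k) = x i := by
  classical
  -- The identity law is not assumed: `φ (le_refl i)` is idempotent and surjective.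
  have hrefl : ∀ (i : J) (q : K i), φ (le_refl i) q = q := fun i q => by
    obtain ⟨q, rfl⟩ := hsurj (le_refl i) q
    exact hcomp _ _ q
  -- Families through `p` that are only required to be the images of their own `k`-th entry below
  -- `k`. These closed sets are non-empty and decrease with `k`; a common point is a thread.
  set S : {k : J // j ≤ k} → Set (∀ i, K i) := fun k =>
    {x | φ k.2 (x k.1) = p} ∩ ⋂ (i : J) (h : i ≤ k.1), {x | φ h (x k.1) = x i} with hS
  have hne : ∀ i, Nonempty (K i) := fun i => by
    obtain ⟨k, hik, hjk⟩ := exists_ge_ge i j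
    obtain ⟨q, -⟩ := hsurj hjk p
    exact ⟨φ hik q⟩
  have hSc : ∀ k, IsClosed (S k) := fun k =>
    (isClosed_eq ((hφ k.2).comp (continuous_apply k.1)) continuous_const).inter
      (isClosed_iInter fun i => isClosed_iInter fun h =>
        isClosed_eq ((hφ h).comp (continuous_apply k.1)) (continuous_apply i))
  have hSn : ∀ k, (S k).Nonempty := fun k => by
    obtain ⟨q, hq⟩ := hsurj k.2 p
    refine ⟨fun i => if h : i ≤ k.1 then φ h q else (hne i).some, ?_, ?_⟩
    · change φ _ (dite _ _ _) = p
      rw [dif_pos le_rfl, hrefl, hq]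
    · refine Set.mem_iInter₂.2 fun i h => ?_
      change φ _ (dite _ _ _) = dite _ _ _
      rw [dif_pos le_rfl, dif_pos h, hrefl]
  have hSd : Directed (· ⊇ ·) S := fun k l => by
    obtain ⟨m, hkm, hlm⟩ := exists_ge_ge k.1 l.1
    refine ⟨⟨m, k.2.trans hkm⟩, ?_, ?_⟩ <;>
    · rintro x ⟨hx1, hx2⟩
      have hx2 := Set.mem_iInter₂.1 hx2
      refine ⟨?_, Set.mem_iInter₂.2 fun i h => ?_⟩
      · first
        | exact (congrArg _ (hx2 k.1 hkm).symm).trans ((hcomp _ _ _).trans hx1)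
        | exact (congrArg _ (hx2 l.1 hlm).symm).trans ((hcomp _ _ _).trans hx1)
      · first
        | exact (congrArg _ (hx2 k.1 hkm).symm).trans
            ((hcomp _ _ _).trans (hx2 i (h.trans hkm)))
        | exact (congrArg _ (hx2 l.1 hlm).symm).trans
            ((hcomp _ _ _).trans (hx2 i (h.trans hlm)))
  have : Nonempty {k : J // j ≤ k} := ⟨⟨j, le_rfl⟩⟩
  obtain ⟨x, hx⟩ := IsCompact.nonempty_iInter_of_directed_nonempty_isCompact_isClosed S hSd hSn
    (fun k => (hSc k).isCompact) hSc
  have hx' : ∀ k (h : j ≤ k) i (hi : i ≤ k), φ hi (x k) = x i := fun k h i hi =>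
    Set.mem_iInter₂.1 (Set.mem_iInter.1 hx ⟨k, h⟩).2 i hi
  refine ⟨x, ?_, fun {i k} h => ?_⟩
  · rw [← hrefl j (x j)]
    exact (Set.mem_iInter.1 hx ⟨j, le_rfl⟩).1
  · obtain ⟨m, hkm, hjm⟩ := exists_ge_ge k j
    rw [← hx' m hjm k hkm, hcomp, hx' m hjm]

/-! ## Directed colimits of MV-algebras -/

namespace MVCat

variable {J : Type u} [Preorder J] {F : J ⥤ MVCat.{u}}

theorem map_map (c : Cocone F) {i j : J} (h : i ≤ j) (b : (F.obj i).carrier) :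
    fn (c.ι.app j) (fn (F.map (homOfLE h)) b) = fn (c.ι.app i) b :=
  congrFun (congrArg fn (c.w (homOfLE h))) b

variable [IsDirectedOrder J]

/-- A cocone whose legs are injective and jointly surjective is a colimit. -/
theorem nonempty_isColimit (c : Cocone F)
    (hs : ∀ a : c.pt.carrier, ∃ (j : J) (b : (F.obj j).carrier), fn (c.ι.app j) b = a)
    (hi : ∀ j, Function.Injective (fn (c.ι.app j))) : Nonempty (IsColimit c) := by
  choose j b hb using hs
  -- The value of a cocone does not depend on the chosen representative: two representatives become
  -- equal at a common upper index, since the legs of `c` are injective.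
  have key : ∀ (s : Cocone F) (k : J) (d : (F.obj k).carrier),
      fn (s.ι.app (j (fn (c.ι.app k) d))) (b (fn (c.ι.app k) d)) = fn (s.ι.app k) d := by
    intro s k d
    set a := fn (c.ι.app k) d with ha
    obtain ⟨m, h1, h2⟩ := exists_ge_ge (j a) k
    rw [← map_map s h1, ← map_map s h2]
    congr 1
    refine hi m ?_
    rw [map_map, map_map, hb]
  refine ⟨{
    desc := fun s => (⟨fun a => fn (s.ι.app (j a)) (b a), ?_, ?_, ?_⟩ : MVHom _ _)
    fac := fun s k => MVHom.ext (funext fun d => key s k d)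
    uniq := fun s m hm => MVHom.ext (funext fun a => ?_) }⟩
  · have := key s (j MVAlgebra.zero) MVAlgebra.zero
    rwa [show fn (c.ι.app (j MVAlgebra.zero)) MVAlgebra.zero = MVAlgebra.zero from
      MVHom.map_zero _, show fn (s.ι.app (j MVAlgebra.zero)) MVAlgebra.zero = MVAlgebra.zero from
      MVHom.map_zero _] at this
  · intro x y
    obtain ⟨k, h1, h2⟩ := exists_ge_ge (j x) (j y)
    have hx := (map_map c h1 (b x)).trans (hb x)
    have hy := (map_map c h2 (b y)).trans (hb y)
    have := key s k (MVAlgebra.oplus (fn (F.map (homOfLE h1)) (b x))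
      (fn (F.map (homOfLE h2)) (b y)))
    rw [show fn (c.ι.app k) (MVAlgebra.oplus _ _) = _ from MVHom.map_oplus _ _ _,
      show fn (s.ι.app k) (MVAlgebra.oplus _ _) = _ from MVHom.map_oplus _ _ _] at this
    change fn (s.ι.app (j (MVAlgebra.oplus (fn (c.ι.app k) _) (fn (c.ι.app k) _)))) (b
      (MVAlgebra.oplus (fn (c.ι.app k) _) (fn (c.ι.app k) _))) =
      MVAlgebra.oplus (fn (s.ι.app k) _) (fn (s.ι.app k) _) at this
    rwa [hx, hy, map_map, map_map] at this
  · intro x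
    have := key s (j x) (MVAlgebra.neg (b x))
    rw [show fn (c.ι.app (j x)) (MVAlgebra.neg _) = _ from MVHom.map_neg _ _,
      show fn (s.ι.app (j x)) (MVAlgebra.neg _) = _ from MVHom.map_neg _ _] at this
    change fn (s.ι.app (j (MVAlgebra.neg (fn (c.ι.app (j x)) _)))) (b
      (MVAlgebra.neg (fn (c.ι.app (j x)) _))) = MVAlgebra.neg (fn (s.ι.app (j x)) _) at this
    rwa [hb] at this
  · have := congrFun (congrArg fn (hm (j a))) (b a)
    change fn m (fn (c.ι.app (j a)) (b a)) = _ at this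
    rw [hb] at this
    exact this

variable [Nonempty J]

/-- The legs of a directed colimit of MV-algebras are jointly surjective. -/
theorem exists_rep {c : Cocone F} (hc : IsColimit c) (a : c.pt.carrier) :
    ∃ (j : J) (b : (F.obj j).carrier), fn (c.ι.app j) b = a := by
  -- By directedness the union of the images of the legs is a subalgebra, through which the cocone
  -- factors. The induced map to it, followed by the inclusion, is the identity by uniqueness.
  set S := {a : c.pt.carrier // ∃ (j : J) (b : (F.obj j).carrier), fn (c.ι.app j) b = a}
  let _ : MVAlgebra S := {
    zero := ⟨MVAlgebra.zero, Classical.arbitrary J, MVAlgebra.zero, MVHom.map_zero _⟩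
    oplus := fun x y => ⟨MVAlgebra.oplus x.1 y.1, by
      obtain ⟨x, i, a, rfl⟩ := x
      obtain ⟨y, j, b, rfl⟩ := y
      obtain ⟨k, h1, h2⟩ := exists_ge_ge i j
      refine ⟨k, MVAlgebra.oplus (fn (F.map (homOfLE h1)) a) (fn (F.map (homOfLE h2)) b), ?_⟩
      exact (MVHom.map_oplus _ _ _).trans
        (congrArg₂ MVAlgebra.oplus (map_map c h1 a) (map_map c h2 b))⟩
    neg := fun x => ⟨MVAlgebra.neg x.1, by
      obtain ⟨x, i, a, rfl⟩ := x
      exact ⟨i, MVAlgebra.neg a, MVHom.map_neg _ _⟩⟩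
    oplus_assoc := fun _ _ _ => Subtype.ext (MVAlgebra.oplus_assoc _ _ _)
    oplus_comm := fun _ _ => Subtype.ext (MVAlgebra.oplus_comm _ _)
    oplus_zero := fun _ => Subtype.ext (MVAlgebra.oplus_zero _)
    neg_neg := fun _ => Subtype.ext (MVAlgebra.neg_neg _)
    oplus_neg_zero := fun _ => Subtype.ext (MVAlgebra.oplus_neg_zero _)
    lukasiewicz := fun _ _ => Subtype.ext (MVAlgebra.lukasiewicz _ _) }
  let leg : ∀ j, MVHom (F.obj j).carrier S := fun j =>
    ⟨fun b => ⟨fn (c.ι.app j) b, j, b, rfl⟩, Subtype.ext (MVHom.map_zero _),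
      fun _ _ => Subtype.ext (MVHom.map_oplus _ _ _), fun _ => Subtype.ext (MVHom.map_neg _ _)⟩
  let s : Cocone F := {
    pt := ⟨S⟩
    ι := {
      app := leg
      naturality := fun i j f => MVHom.ext (funext fun b => Subtype.ext
        (congrFun (congrArg fn (c.w f)) b)) } }
  let incl : s.pt ⟶ c.pt := (⟨Subtype.val, rfl, fun _ _ => rfl, fun _ => rfl⟩ : MVHom S _)
  have hid : hc.desc s ≫ incl = 𝟙 c.pt := hc.hom_ext fun j => by
    rw [← Category.assoc, hc.fac, Category.comp_id]
    rfl
  have ha : (fn (hc.desc s) a : S).1 = a := congrFun (congrArg fn hid) a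
  rw [← ha]
  exact (fn (hc.desc s) a : S).2

theorem exists_rep_finset {c : Cocone F} (hc : IsColimit c) (Z : Finset c.pt.carrier) :
    ∃ (j : J) (β : Z → (F.obj j).carrier), ∀ z : Z, fn (c.ι.app j) (β z) = (z : c.pt.carrier) := by
  classical
  choose j b hb using exists_rep hc
  obtain ⟨k, hk⟩ := (Z.image j).exists_le
  exact ⟨k, fun z => fn (F.map (homOfLE (hk _ (Finset.mem_image_of_mem j z.2)))) (b z), fun z => by
    rw [map_map, hb]⟩

theorem exists_rep_pair {c : Cocone F} (hc : IsColimit c) (x y : c.pt.carrier) :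
    ∃ (j : J) (a b : (F.obj j).carrier), fn (c.ι.app j) a = x ∧ fn (c.ι.app j) b = y := by
  obtain ⟨i, a, rfl⟩ := exists_rep hc x
  obtain ⟨j, b, rfl⟩ := exists_rep hc y
  obtain ⟨k, h1, h2⟩ := exists_ge_ge i j
  exact ⟨k, _, _, map_map c h1 a, map_map c h2 b⟩

end MVCat

/-- A copy of `[0,1]` in the universe of the category, needed as the vertex of a cocone. -/
noncomputable instance : MVAlgebra (ULift.{u} I) where
  zero := ⟨MVAlgebra.zero⟩
  oplus x y := ⟨MVAlgebra.oplus x.down y.down⟩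
  neg x := ⟨MVAlgebra.neg x.down⟩
  oplus_assoc _ _ _ := congrArg ULift.up (MVAlgebra.oplus_assoc _ _ _)
  oplus_comm _ _ := congrArg ULift.up (MVAlgebra.oplus_comm _ _)
  oplus_zero _ := congrArg ULift.up (MVAlgebra.oplus_zero _)
  neg_neg _ := congrArg ULift.up (MVAlgebra.neg_neg _)
  oplus_neg_zero _ := congrArg ULift.up (MVAlgebra.oplus_neg_zero _)
  lukasiewicz _ _ := congrArg ULift.up (MVAlgebra.lukasiewicz _ _)

namespace MVCat

variable {J : Type u} [Preorder J] [IsDirectedOrder J] {F : J ⥤ MVCat.{u}}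

/-- Homomorphisms to the standard MV-algebra extend from the terms of a directed system of
embeddings to its colimit. -/
theorem exists_extension {c : Cocone F} (hc : IsColimit c)
    (hsep : ∀ (j : J) (f : (F.obj j).carrier),
      (∀ x ∈ mvSpec (F.obj j).carrier, x f = MVAlgebra.zero) → f = MVAlgebra.zero)
    (hinj : ∀ (i j : J) (f : i ⟶ j), Function.Injective (fn (F.map f)))
    (j : J) {y : (F.obj j).carrier → I} (hy : y ∈ mvSpec (F.obj j).carrier) :
    ∃ x ∈ mvSpec c.pt.carrier, ∀ b, x (fn (c.ι.app j) b) = y b := by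
  have : ∀ j, CompactSpace (mvSpec (F.obj j).carrier) := fun j =>
    isCompact_iff_compactSpace.1 isClosed_mvSpec.isCompact
  -- The spectra form an inverse system of compact spaces whose maps are surjective by
  -- `exists_extension_mvSpec`. A thread through `y` is a cocone to `[0,1]`.
  obtain ⟨x, hxj, hx⟩ := exists_thread (K := fun j => mvSpec (F.obj j).carrier)
    (fun {i k} h x => ⟨x.1 ∘ fn (F.map (homOfLE h)), comp_mem_mvSpec x.2 _⟩)
    (fun {i k} h => Continuous.subtype_mk
      (f := fun x : mvSpec (F.obj k).carrier => x.1 ∘ fn (F.map (homOfLE h)))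
      (continuous_pi fun b => (continuous_apply (fn (F.map (homOfLE h)) b)).comp
        continuous_subtype_val) _)
    (fun {i k l} h h' x => Subtype.ext (funext fun b => by
      have := congrFun (congrArg fn (F.map_comp (homOfLE h) (homOfLE h'))) b
      exact congrArg x.1 this.symm))
    (fun {i k} h y => by
      obtain ⟨x, hx, hxy⟩ := exists_extension_mvSpec (F.map (homOfLE h))
        (hinj _ _ (homOfLE h)) (hsep k) y.2
      exact ⟨⟨x, hx⟩, Subtype.ext hxy⟩) j ⟨y, hy⟩
  let s : Cocone F := {
    pt := ⟨ULift.{u} I⟩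
    ι := {
      app := fun i => (⟨fun b => ⟨(x i).1 b⟩,
        congrArg ULift.up (mem_mvSpec_iff.1 (x i).2).1,
        fun a b => congrArg ULift.up ((mem_mvSpec_iff.1 (x i).2).2.1 a b),
        fun a => congrArg ULift.up ((mem_mvSpec_iff.1 (x i).2).2.2 a)⟩ : MVHom _ (ULift.{u} I))
      naturality := fun i k f => MVHom.ext (funext fun b => congrArg ULift.up
        (congrFun (congrArg Subtype.val (hx (leOfHom f))) b)) } }
  let d : MVHom c.pt.carrier (ULift.{u} I) := hc.desc s
  let down : MVHom (ULift.{u} I) I := ⟨ULift.down, rfl, fun _ _ => rfl, fun _ => rfl⟩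
  refine ⟨_, ⟨down.comp d, rfl⟩, fun b => ?_⟩
  have h1 : d.toFun (fn (c.ι.app j) b) = ⟨(x j).1 b⟩ := congrFun (congrArg fn (hc.fac s j)) b
  have h2 : (x j).1 b = y b := congrFun (congrArg Subtype.val hxj) b
  exact (congrArg ULift.down h1).trans h2

/-- A directed colimit of finitely generated polyhedral MV-algebras and embeddings is
polyhedral. -/
theorem isPolyhedralMV_of_isColimit [Nonempty J] {c : Cocone F} (hc : IsColimit c)
    (hF : ∀ j, IsFGPolyhedralMV (F.obj j).carrier)
    (hinj : ∀ (i j : J) (f : i ⟶ j), Function.Injective (fn (F.map f))) :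
    IsPolyhedralMV c.pt.carrier := by
  choose n P hP e he using hF
  -- `hext` and `hrestr` together say that the restrictions of homomorphisms of the colimit to the
  -- `j`-th term are exactly the evaluations at points of `P j`.
  have hext := @exists_extension J _ _ F c hc (fun j f => eq_zero_of_mvSpec (e j) (he j).1 f) hinj
  have hrestr : ∀ j, ∀ x ∈ mvSpec c.pt.carrier, ∃ p : P j, ∀ b,
      x (fn (c.ι.app j) b) = ((e j).toFun b).1 p := fun j x hx =>
    exists_eq_eval (hP j).isClosed (e j) (he j).1 (comp_mem_mvSpec hx (c.ι.app j))
  have hZ : ∀ {Z : Finset c.pt.carrier} {j : J} (β : Z → (F.obj j).carrier),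
      IsZMap (fun p : P j => (⟨fun z => ((e j).toFun (β z)).1 p, trivial⟩ :
        (Set.univ : Set (Z → I)))) := fun {Z j} β z => ((e j).toFun (β z)).2
  refine ⟨c.pt.carrier, mvSpec c.pt.carrier, isClosed_mvSpec, fun Z => ?_,
    ⟨fun a => ⟨fun x => x.1 a, _, IsCubeZFun.proj a, fun _ => rfl⟩, ?_, ?_, ?_⟩, ?_, ?_⟩
  -- Finitely many elements live in one term, so the projection of the spectrum to `Z` is the range
  -- of the `ℤ`-map on `P j` with coordinates `β`.
  · obtain ⟨j, β, hβ⟩ := exists_rep_finset hc Z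
    convert (hZ β).isPolyhedron_range (hP j) using 1
    ext q
    constructor
    · rintro ⟨x, hx, rfl⟩
      obtain ⟨p, hp⟩ := hrestr j x hx
      exact ⟨p, funext fun z => (hp (β z)).symm.trans (congrArg x (hβ z))⟩
    · rintro ⟨p, rfl⟩
      obtain ⟨x, hx, hxp⟩ := hext j (eval_mem_mvSpec (e j) p)
      exact ⟨x, hx, funext fun z =>
        (congrArg x (hβ z)).symm.trans (hxp (β z))⟩
  · exact Subtype.ext (funext fun x => (mem_mvSpec_iff.1 x.2).1)
  · exact fun a b => Subtype.ext (funext fun x => (mem_mvSpec_iff.1 x.2).2.1 a b)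
  · exact fun a => Subtype.ext (funext fun x => (mem_mvSpec_iff.1 x.2).2.2 a)
  · intro a b hab
    obtain ⟨j, a, b, rfl, rfl⟩ := exists_rep_pair hc a b
    congr 1
    refine (he j).1 (Subtype.ext (funext fun p => ?_))
    obtain ⟨x, hx, hxp⟩ := hext j (eval_mem_mvSpec (e j) p)
    have : x (fn (c.ι.app j) a) = x (fn (c.ι.app j) b) :=
      congrFun (congrArg Subtype.val hab) ⟨x, hx⟩
    rwa [hxp, hxp] at this
  -- A `ℤ`-function on the spectrum is `g` of finitely many elements of the algebra. Represented in
  -- one term, these give a `ℤ`-function on `P j`, hence an element with the required values.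
  · rintro ⟨f, ξ, ⟨s, g, hg, hξ⟩, hf⟩
    obtain ⟨j, β, hβ⟩ := exists_rep_finset hc s
    have hgZ : IsZFun (fun q : (Set.univ : Set (s → I)) => g q) :=
      ⟨g, hg.isCubeZFun, fun _ => rfl⟩
    obtain ⟨b, hb⟩ := (he j).2 ⟨_, hgZ.comp (hZ β)⟩
    refine ⟨fn (c.ι.app j) b, Subtype.ext (funext fun x => ?_)⟩
    obtain ⟨p, hp⟩ := hrestr j x.1 x.2
    change x.1 _ = f x
    rw [hp, hb, hf, hξ]
    exact congrArg g (funext fun z =>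
      (hp (β z)).symm.trans (congrArg x.1 (hβ z)))

end MVCat

/-! ## Finite-dimensional projections -/

section Projections

variable {Y : Type u} {X : Set (Y → I)}

/-- Basic neighbourhoods in the product topology restrict only finitely many coordinates. -/
theorem IsClosed.mem_of_forall_restrict (hX : IsClosed X) {x : Y → I}
    (hx : ∀ Z : Finset Y, Z.restrict x ∈ (Z.restrict : (Y → I) → (Z → I)) '' X) : x ∈ X := by
  rw [← hX.closure_eq, mem_closure_iff]
  intro U hU hxU
  obtain ⟨Z, u, hu, hZU⟩ := isOpen_pi_iff.1 hU x hxU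
  obtain ⟨p, hp, hpx⟩ := hx Z
  refine ⟨p, hZU fun i hi => ?_, hp⟩
  rw [show p i = x i from congrFun hpx ⟨i, hi⟩]
  exact (hu i hi).2

theorem IsCompact.isClosed_restrict_image (hX : IsCompact X) (Z : Finset Y) :
    IsClosed ((Z.restrict : (Y → I) → (Z → I)) '' X) :=
  (hX.image (Finset.continuous_restrict Z)).isClosed

/-- The inverse system of the finite-dimensional projections of a compact subset of a cube. -/
def finiteProjections (hX : IsCompact X) : (Finset Y)ᵒᵖ ⥤ CubeSpace.{u} where
  obj Z := ⟨Z.unop, (Z.unop.restrict : (Y → I) → (Z.unop → I)) '' X,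
    hX.isClosed_restrict_image Z.unop⟩
  map f := ⟨fun p => ⟨Finset.restrict₂ (π := fun _ => I) (leOfHom f.unop) p.1, by
    obtain ⟨_, x, hx, rfl⟩ := p
    exact ⟨x, hx, rfl⟩⟩,
    fun j => ⟨_, IsCubeZFun.proj ⟨j.1, leOfHom f.unop j.2⟩, fun _ => rfl⟩⟩

/-- The projections of a compact subset of a cube to finitely many coordinates. -/
def finiteProjectionsCone (hX : IsCompact X) :
    (Functor.const (Finset Y)ᵒᵖ).obj (CubeSpace.mk Y X hX.isClosed) ⟶ finiteProjections hX where
  app Z := ⟨fun x => ⟨Z.unop.restrict x.1, x.1, x.2, rfl⟩,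
    fun j => ⟨_, IsCubeZFun.proj j.1, fun _ => rfl⟩⟩

theorem surjective_finiteProjectionsCone (hX : IsCompact X) (Z : (Finset Y)ᵒᵖ) :
    Function.Surjective (CubeSpace.fn ((finiteProjectionsCone hX).app Z)) := by
  rintro ⟨_, x, hx, rfl⟩
  exact ⟨⟨x, hx⟩, rfl⟩

theorem surjective_finiteProjections_map (hX : IsCompact X) {Z Z' : (Finset Y)ᵒᵖ} (f : Z ⟶ Z') :
    Function.Surjective (CubeSpace.fn ((finiteProjections hX).map f)) := by
  rintro ⟨_, x, hx, rfl⟩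
  exact ⟨⟨Z.unop.restrict x, x, hx, rfl⟩, rfl⟩

/-- The coordinate `y` of the lift is read off from the projection to `{y}`. Compatibility makes
every finite projection of the resulting point lie in that of `X`, and closedness puts the point in
`X`. -/
theorem nonempty_isLimit_finiteProjectionsCone (hX : IsCompact X) :
    Nonempty (IsLimit (Cone.mk _ (finiteProjectionsCone hX))) := by
  classical
  have hval : ∀ (s : Cone (finiteProjections hX)) (q : s.pt.set) (Z : Finset Y) (y : Z),
      (CubeSpace.fn (s.π.app (Opposite.op {(y : Y)})) q).1 ⟨y, Finset.mem_singleton_self _⟩ =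
        (CubeSpace.fn (s.π.app (Opposite.op Z)) q).1 y := fun s q Z y => by
    have hle : ({(y : Y)} : Finset Y) ≤ Z := Finset.singleton_subset_iff.2 y.2
    have := congrFun (congrArg CubeSpace.fn (s.w (homOfLE hle).op)) q
    exact (congrFun (congrArg Subtype.val this) ⟨y, Finset.mem_singleton_self _⟩).symm
  refine ⟨{
    lift := fun s => ⟨fun q => ⟨fun y => (CubeSpace.fn (s.π.app (Opposite.op {y})) q).1
      ⟨y, Finset.mem_singleton_self y⟩, hX.isClosed.mem_of_forall_restrict fun Z => ?_⟩,
      fun y => (s.π.app (Opposite.op {y})).2 ⟨y, Finset.mem_singleton_self y⟩⟩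
    fac := fun s Z => Subtype.ext (funext fun q => Subtype.ext (funext fun y =>
      hval s q Z.unop y))
    uniq := fun s m hm => Subtype.ext (funext fun q => Subtype.ext (funext fun y => ?_)) }⟩
  · obtain ⟨x, hx, h⟩ := (CubeSpace.fn (s.π.app (Opposite.op Z)) q).2
    exact ⟨x, hx, h.trans (funext fun y => (hval s q Z y).symm)⟩
  · have := congrFun (congrArg CubeSpace.fn (hm (Opposite.op {y}))) q
    exact congrFun (congrArg Subtype.val this) ⟨y, Finset.mem_singleton_self y⟩

end Projections

/-! ### Polyhedral algebras as directed colimits -/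

/-- The functor sending a closed subspace of a cube to its algebra of `ℤ`-maps. -/
noncomputable def mcNFunctor : CubeSpace.{u}ᵒᵖ ⥤ MVCat.{u} where
  obj P := ⟨McN P.unop.set⟩
  map f := McN.pullback f.unop.1 f.unop.2

/-- A polyhedral MV-algebra is a directed colimit of finitely generated polyhedral ones. -/
theorem IsPolyhedralMV.exists_isColimit {A : MVCat.{u}} (hA : IsPolyhedralMV A.carrier) :
    ∃ (J : Type u) (_ : Preorder J) (_ : IsDirectedOrder J) (_ : Nonempty J)
      (F : J ⥤ MVCat.{u}) (ι : F ⟶ (Functor.const J).obj A),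
      Nonempty (IsColimit (Cocone.mk A ι)) ∧
      (∀ j : J, IsFGPolyhedralMV (F.obj j).carrier) ∧
      (∀ (i j : J) (f : i ⟶ j), Function.Injective (MVCat.fn (F.map f))) := by
  classical
  obtain ⟨Y, X, hXc, hX, h, hh⟩ := hA
  have hXc := hXc.isCompact
  set G := finiteProjections hXc
  set π := finiteProjectionsCone hXc
  set F : Finset Y ⥤ MVCat.{u} := G.rightOp ⋙ mcNFunctor
  let leg : ∀ Z : Finset Y, MVHom (F.obj Z).carrier A.carrier := fun Z =>
    (h.inverse hh).comp (McN.pullback (π.app (Opposite.op Z)).1 (π.app (Opposite.op Z)).2)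
  let ι : F ⟶ (Functor.const (Finset Y)).obj A :=
    { app := leg, naturality := fun _ _ _ => rfl }
  have hinv : Function.Bijective (h.inverse hh).toFun :=
    (Equiv.ofBijective h.toFun hh).symm.bijective
  refine ⟨Finset Y, inferInstance, inferInstance, inferInstance, F, ι,
    MVCat.nonempty_isColimit _ ?_ ?_, fun Z => isFGPolyhedralMV_mcN (ι := Z) (hX Z), fun Z Z' f =>
      McN.pullback_injective (G.map f.op).2 (surjective_finiteProjections_map hXc f.op)⟩
  -- A `ℤ`-function on `X` factors through finitely many coordinates `Z`, so it comes from the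
  -- algebra of the projection to `Z`.
  · intro a
    obtain ⟨g, rfl⟩ := hinv.2 a
    obtain ⟨g, ξ, ⟨Z, f, hf, hξ⟩, hg⟩ := g
    refine ⟨Z, (⟨fun p => f p.1, f, hf.isCubeZFun, fun _ => rfl⟩ :
      McN ((Z.restrict : (Y → I) → (Z → I)) '' X)), ?_⟩
    refine congrArg (h.inverse hh).toFun (Subtype.ext (funext fun x => ?_))
    exact ((hg x).trans (hξ x)).symm
  · exact fun Z => hinv.1.comp
      (McN.pullback_injective _ (surjective_finiteProjectionsCone hXc _))

/-! ## Limits of inverse systems of polyhedra -/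

section Limits

variable {J : Type u} [Preorder J] [IsDirectedOrder J] [Nonempty J] {F : Jᵒᵖ ⥤ CubeSpace.{u}}

/-- The set of threads of an inverse system, as a subset of a cube. -/
def threadSet (F : Jᵒᵖ ⥤ CubeSpace.{u}) : Set ((Σ j : Jᵒᵖ, (F.obj j).coords) → I) :=
  (fun (t : ∀ j : Jᵒᵖ, (F.obj j).set) q => (t q.1).1 q.2) ''
    {t | ∀ (i j : Jᵒᵖ) (f : i ⟶ j), CubeSpace.fn (F.map f) (t i) = t j}

theorem isClosed_threadSet {J : Type u} [Preorder J] {F : Jᵒᵖ ⥤ CubeSpace.{u}} : IsClosed (threadSet F) := by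
  have : ∀ j, CompactSpace (F.obj j).set := fun j =>
    isCompact_iff_compactSpace.1 (F.obj j).isClosed.isCompact
  refine (IsCompact.image (IsClosed.isCompact ?_) ?_).isClosed
  · simp only [Set.ofPred_forall]
    exact isClosed_iInter fun i => isClosed_iInter fun j => isClosed_iInter fun f =>
      isClosed_eq ((IsZMap.continuous (F.map f).2).comp (continuous_apply i)) (continuous_apply j)
  · exact continuous_pi fun q => (continuous_apply q.2).comp
      (continuous_subtype_val.comp (continuous_apply q.1))

/-- A compact set which is the limit of a directed inverse system of polyhedra and surjective
`ℤ`-maps is a polyhedron. -/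
theorem isInfPolyhedron_of_isLimit {c : Cone F} (hc : IsLimit c)
    (hF : ∀ j, (F.obj j).IsFinDimPolyhedron)
    (hsurj : ∀ (i j : Jᵒᵖ) (f : i ⟶ j), Function.Surjective (CubeSpace.fn (F.map f))) :
    IsInfPolyhedron c.pt.set := by
  classical
  let L : CubeSpace.{u} := ⟨_, threadSet F, isClosed_threadSet⟩
  have hL : ∀ (x : L.set) j, (fun k => x.1 ⟨j, k⟩) ∈ (F.obj j).set := by
    rintro ⟨_, t, ht, rfl⟩ j
    exact (t j).2
  let p : ∀ j, L ⟶ F.obj j := fun j => ⟨fun x => ⟨fun k => x.1 ⟨j, k⟩, hL x j⟩,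
    fun k => ⟨_, IsCubeZFun.proj ⟨j, k⟩, fun _ => rfl⟩⟩
  let s : Cone F := ⟨L, { app := p, naturality := fun i j f => Subtype.ext (funext fun x => by
    obtain ⟨_, t, ht, rfl⟩ := x
    exact (ht i j f).symm) }⟩
  let m : c.pt ⟶ L := ⟨fun x => ⟨fun q => (CubeSpace.fn (c.π.app q.1) x).1 q.2,
    fun j => CubeSpace.fn (c.π.app j) x,
    fun i j f => congrFun (congrArg CubeSpace.fn (c.w f)) x, rfl⟩,
    fun q => (c.π.app q.1).2 q.2⟩
  -- The limit is a retract of the set of threads, so its coordinates are `ℤ`-functions of the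
  -- coordinates of threads.
  have hm : m ≫ hc.lift s = 𝟙 c.pt := hc.hom_ext fun j => by
    rw [Category.assoc, hc.fac, Category.id_comp]
    rfl
  -- A thread through `q` exists by compactness, and `hc.lift s` carries it to a point of the limit
  -- above `q`.
  have hπ : ∀ j, Function.Surjective (CubeSpace.fn (c.π.app j)) := fun j q => by
    have : ∀ j, CompactSpace (F.obj j).set := fun j =>
      isCompact_iff_compactSpace.1 (F.obj j).isClosed.isCompact
    obtain ⟨t, htj, ht⟩ := exists_thread (K := fun j : J => (F.obj (Opposite.op j)).set)
      (fun {i k} h => CubeSpace.fn (F.map (homOfLE h).op))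
      (fun {i k} h => IsZMap.continuous (F.map (homOfLE h).op).2)
      (fun {i k l} h h' x =>
        (congrFun (congrArg CubeSpace.fn (F.map_comp (homOfLE h').op (homOfLE h).op)) x).symm)
      (fun {i k} h => hsurj _ _ _) j.unop q
    let x : L.set := ⟨_, fun j => t j.unop, fun i j f => ht (leOfHom f.unop), rfl⟩
    refine ⟨CubeSpace.fn (hc.lift s) x, ?_⟩
    exact (congrFun (congrArg CubeSpace.fn (hc.fac s j)) x).trans htj
  intro Z
  choose ξ hξ hξl using (hc.lift s).2
  choose S g hg hξg using hξ
  -- The coordinates in `Z` involve finitely many thread coordinates. All of these are determined at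
  -- one index `k`, which gives the `ℤ`-map `θ` with range the projection to `Z`.
  obtain ⟨k, hk⟩ := ((Z.biUnion fun y => (S y)).image fun q => q.1.unop).exists_le
  have hk' : ∀ y ∈ Z, ∀ q ∈ S y, q.1.unop ≤ k := fun y hy q hq =>
    hk _ (Finset.mem_image_of_mem _ (Finset.mem_biUnion.2 ⟨y, hy, hq⟩))
  let φ : ∀ (y : Z) (q : S y), Opposite.op k ⟶ q.1.1 := fun y q => (homOfLE (hk' y y.2 q q.2)).op
  let θ : (F.obj (Opposite.op k)).set → (Set.univ : Set (Z → I)) := fun x =>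
    ⟨fun y => g y fun q => (CubeSpace.fn (F.map (φ y q)) x).1 q.1.2, trivial⟩
  have hθ : IsZMap θ := fun y => by
    have h1 : IsZFun (fun r : (Set.univ : Set (S y → I)) => g y r) :=
      ⟨g y, (hg y).isCubeZFun, fun _ => rfl⟩
    exact h1.comp (η := fun x => ⟨fun q => (CubeSpace.fn (F.map (φ y q)) x).1 q.1.2, trivial⟩)
      fun q => (F.map (φ y q)).2 q.1.2
  have hval : ∀ (x : c.pt.set) (y : Z),
      (θ (CubeSpace.fn (c.π.app (Opposite.op k)) x)).1 y = x.1 y := fun x y => by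
    have h1 : x.1 y = (CubeSpace.fn (hc.lift s) (CubeSpace.fn m x)).1 y :=
      (congrFun (congrArg Subtype.val (congrFun (congrArg CubeSpace.fn hm) x)) (y : c.pt.coords)).symm
    rw [h1]
    refine Eq.trans ?_ ((hξl y _).trans (hξg y _)).symm
    refine congrArg (g y) (funext fun q => ?_)
    exact congrFun (congrArg Subtype.val (congrFun (congrArg CubeSpace.fn (c.w (φ y q))) x)) q.1.2
  obtain ⟨_, hP⟩ := hF (Opposite.op k)
  convert hθ.isPolyhedron_range hP using 1
  ext r
  constructor
  · rintro ⟨x, hx, rfl⟩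
    exact ⟨CubeSpace.fn (c.π.app (Opposite.op k)) ⟨x, hx⟩, funext fun y => hval ⟨x, hx⟩ y⟩
  · rintro ⟨q, rfl⟩
    obtain ⟨x, rfl⟩ := hπ (Opposite.op k) q
    exact ⟨x.1, x.2, funext fun y => (hval x y).symm⟩

end Limits

/-! ### The two characterisations -/

theorem mainTheorem10 :
    (∀ A : MVCat.{u},
      IsPolyhedralMV A.carrier ↔
        ∃ (J : Type u) (_ : Preorder J) (_ : IsDirectedOrder J) (_ : Nonempty J)
          (F : J ⥤ MVCat.{u}) (ι : F ⟶ (Functor.const J).obj A),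
          Nonempty (IsColimit (Cocone.mk A ι)) ∧
          (∀ j : J, IsFGPolyhedralMV (F.obj j).carrier) ∧
          (∀ (i j : J) (f : i ⟶ j), Function.Injective (MVCat.fn (F.map f)))) ∧
    (∀ (Y : Type u) (X : Set (Y → unitInterval)) (hX : IsCompact X),
      IsInfPolyhedron X ↔
        ∃ (J : Type u) (_ : Preorder J) (_ : IsDirectedOrder J) (_ : Nonempty J)
          (F : Jᵒᵖ ⥤ CubeSpace.{u})
          (π : (Functor.const Jᵒᵖ).obj (CubeSpace.mk Y X hX.isClosed) ⟶ F),
          Nonempty (IsLimit (Cone.mk (CubeSpace.mk Y X hX.isClosed) π)) ∧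
          (∀ j : Jᵒᵖ, (F.obj j).IsFinDimPolyhedron) ∧
          (∀ (i j : Jᵒᵖ) (f : i ⟶ j), Function.Surjective (CubeSpace.fn (F.map f)))) := by
  classical
  refine ⟨fun A => ⟨fun hA => hA.exists_isColimit, ?_⟩, fun Y X hX => ⟨fun h => ?_, ?_⟩⟩
  · rintro ⟨J, _, _, _, F, ι, ⟨hc⟩, hF, hinj⟩
    exact MVCat.isPolyhedralMV_of_isColimit hc hF hinj
  · exact ⟨Finset Y, inferInstance, inferInstance, inferInstance, finiteProjections hX,
      finiteProjectionsCone hX, nonempty_isLimit_finiteProjectionsCone hX,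
      fun Z => ⟨inferInstanceAs (Finite Z.unop), h Z.unop⟩,
      fun _ _ f => surjective_finiteProjections_map hX f⟩
  · rintro ⟨J, _, _, _, F, π, ⟨hc⟩, hF, hsurj⟩
    exact isInfPolyhedron_of_isLimit hc hF hsurj
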